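/- Let $n\ge 1$ and let $\mathrm{Symm}(n,\mathbb F)$ be the space of symmetric $n\times n$ matrices over $\mathbb F$. Put \[ D^{III}_n=\{Z\in\mathrm{Symm}(n,\mathbb C): I_n-Z\overline Z>0\},\qquad \mathscr S_n=\{Z\in\mathrm{Symm}(n,\mathbb C): \mathrm{Im}(Z)>0\}. \] Let $v$ be the Lebesgue measure on $\mathrm{Symm}(n,\mathbb C)$ normalized by $v(D^{III}_n)=1$. For $D$ either of these domains let $\mathcal A^2(D)$ be the space of holomorphic functions in $L^2(D,v)$ and let $K_D:D\times D\to\mathbb C$ be the Bergman kernel of $D$, that is, the smooth function, holomorphic in the first and anti-holomorphic in the second variable, such that $\overline{K_D(Z,\cdot)}\in\mathcal A^2(D)$ for every $Z\in D$ and such that $f\mapsto\int_D f(W)K_D(\cdot,W)\,dv(W)$ is the orthogonal projection of $L^2(D,v)$ onto $\mathcal A^2(D)$. With respect to the coordinates $z_{lm}$ $(l\le m)$ of $\mathrm{Symm}(n,\mathbb C)$, the normalized Bergman metric of $D$ is \[ g^D=c_D\sum_{l\le m,\ j\le k}\frac{\partial^2\log K_D(Z,Z)}{\partial z_{lm}\,\partial\overline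 z_{jk}}\,dz_{lm}\otimes d\overline z_{jk}, \qquad c_{D^{III}_n}=\tfrac1{n+1},\quad c_{\mathscr S_n}=\tfrac4{n+1}, \] and its Kähler form is $\omega^D=(2\,\mathrm{Re}\,g^D)(J\,\cdot,\cdot)=-2\,\mathrm{Im}\,g^D$, where $J$ is multiplication by $i$. \textbf{Theorem.} For both domains the Bergman kernel $K_D$ exists and $K_D(Z,Z)>0$ for all $Z\in D$. The Bergman metrics are given by \begin{align*} g_Z^{D^{III}_n}(U,V)&=\mathrm{tr}\big((I_n-Z\overline Z)^{-1}U(I_n-\overline ZZ)^{-1}\overline V\big) && (Z\in D^{III}_n),\\ g_Z^{\mathscr S_n}(U,V)&=\mathrm{tr}\big(\mathrm{Im}(Z)^{-1}U\,\mathrm{Im}(Z)^{-1}\overline V\big) && (Z\in\mathscr S_n), \end{align*} and the Kähler forms are given by \begin{align*} \omega_Z^{D^{III}_n}(U,V)={}& i\,\mathrm{tr}\big((I_n-Z\overline Z)^{-1}U(I_n-\overline ZZ)^{-1}\overline V\big)\\ &-i\,\mathrm{tr}\big((I_n-\overline ZZ)^{-1}\overline U(I_n-Z\overline Z)^{-1}V\big)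 && (Z\in D^{III}_n),\\ \omega_Z^{\mathscr S_n}(U,V)={}&2\,\mathrm{tr}\big(\mathrm{Im}(Z)^{-1}\mathrm{Re}(U)\,\mathrm{Im}(Z)^{-1}\mathrm{Im}(V)\big)\\ &-2\,\mathrm{tr}\big(\mathrm{Im}(Z)^{-1}\mathrm{Im}(U)\,\mathrm{Im}(Z)^{-1}\mathrm{Re}(V)\big) && (Z\in\mathscr S_n), \end{align*} for all $U,V\in\mathrm{Symm}(n,\mathbb C)$. Here $\overline{\,\cdot\,}$, $\mathrm{Re}$ and $\mathrm{Im}$ of matrices are taken entrywise. -/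

import Mathlib

open scoped ContDiff ComplexConjugate ComplexOrder
open MeasureTheory

noncomputable section

namespace CartanIII

/-- The complex vector space `Symm(n, ℂ)` of symmetric `n × n` matrices, in its canonical complex
linear coordinates `z_{jk}`, `j ≤ k`. The index set of these coordinates is the set `Sym2 (Fin n)`
of unordered pairs `s(j, k) = s(k, j)`. The product structure supplies the topology, the smooth and
complex structures and the Lebesgue measure `volume`. -/
abbrev Symm (n : ℕ) : Type := Sym2 (Fin n) → ℂ

variable {n : ℕ}

/-- The symmetric matrix with coordinates `z_{jk}`. -/
def mat (Z : Symm n) : Matrix (Fin n) (Fin n) ℂ := Matrix.of fun j k => Z s(j, k)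

theorem mat_isSymm (Z : Symm n) : (mat Z).IsSymm := by
  ext j k
  simp [mat, Sym2.eq_swap]

/-- Every symmetric matrix is `mat Z` for exactly one `Z`. -/
theorem existsUnique_mat_eq {A : Matrix (Fin n) (Fin n) ℂ} (hA : A.IsSymm) :
    ∃! Z : Symm n, mat Z = A := by
  refine ⟨fun p => Sym2.lift ⟨fun j k => A j k, fun j k => hA.apply k j⟩ p, ?_, ?_⟩
  · ext j k
    simp [mat]
  · rintro Z rfl
    funext p
    induction p with
    | _ j k => simp [mat]

/-- The entrywise complex conjugate of a matrix. -/
def cbar (A : Matrix (Fin n) (Fin n) ℂ) : Matrix (Fin n) (Fin n) ℂ := A.map (starRingEnd ℂ)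

/-- The entrywise real part of a matrix. -/
def reM (A : Matrix (Fin n) (Fin n) ℂ) : Matrix (Fin n) (Fin n) ℝ := A.map Complex.re

/-- The entrywise imaginary part of a matrix. -/
def imM (A : Matrix (Fin n) (Fin n) ℂ) : Matrix (Fin n) (Fin n) ℝ := A.map Complex.im

/-- A real matrix viewed as a complex matrix. -/
def toC (A : Matrix (Fin n) (Fin n) ℝ) : Matrix (Fin n) (Fin n) ℂ := A.map Complex.ofReal

/-- The Cartan domain of type III: symmetric `Z` with `I - Z Z̄ > 0`. -/
def discDomain (n : ℕ) : Set (Symm n) := {Z | (1 - mat Z * cbar (mat Z)).PosDef}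

/-- The generalized Siegel domain: symmetric `Z` with `Im Z > 0`. -/
def siegelDomain (n : ℕ) : Set (Symm n) := {Z | (imM (mat Z)).PosDef}

/-- The Lebesgue measure on `Symm(n, ℂ)`, normalized so that the Cartan domain of type III has
measure one. -/
def normMeasure (n : ℕ) : Measure (Symm n) :=
  (volume (discDomain n))⁻¹ • (volume : Measure (Symm n))

/-- Membership in the Bergman space `𝒜²(D)` of holomorphic functions in `L²(D, μ)`.
The values of functions off `D` play no role. -/
def MemBergman (D : Set (Symm n)) (μ : Measure (Symm n)) (f : Symm n → ℂ) : Prop :=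
  DifferentiableOn ℂ f D ∧ MemLp f 2 (μ.restrict D)

/-- `h` is the orthogonal projection of `f` onto the Bergman space of `D`: it lies in the Bergman
space, and `f - h` is orthogonal to every function in the Bergman space. -/
def IsBergmanProjection (D : Set (Symm n)) (μ : Measure (Symm n)) (f h : Symm n → ℂ) : Prop :=
  MemBergman D μ h ∧ ∀ φ, MemBergman D μ φ → ∫ W in D, (f W - h W) * conj (φ W) ∂μ = 0

/-- `K` is the reproducing Bergman kernel of `D` with respect to the measure `μ`. -/
structure IsBergmanKernel (D : Set (Symm n)) (μ : Measure (Symm n)) (K : Symm n → Symm n → ℂ) :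
    Prop where
  smooth : ContDiffOn ℝ ∞ (fun p : Symm n × Symm n => K p.1 p.2) (D ×ˢ D)
  holomorphic : ∀ W ∈ D, DifferentiableOn ℂ (fun Z => K Z W) D
  /-- In particular `K` is anti-holomorphic in the second variable. -/
  conj_mem : ∀ Z ∈ D, MemBergman D μ (fun W => conj (K Z W))
  projection : ∀ f : Symm n → ℂ, MemLp f 2 (μ.restrict D) →
    IsBergmanProjection D μ f (fun Z => ∫ W in D, f W * K Z W ∂μ)

/-- The Bergman kernel of `D` (its values off `D × D` are irrelevant). -/
def bergmanKernel (D : Set (Symm n)) (μ : Measure (Symm n)) : Symm n → Symm n → ℂ :=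
  Classical.epsilon (IsBergmanKernel D μ)

/-- The Wirtinger derivative `∂f/∂z_a = (∂f/∂x_a - i ∂f/∂y_a) / 2`. -/
def dz (a : Sym2 (Fin n)) (f : Symm n → ℂ) (Z : Symm n) : ℂ :=
  (fderiv ℝ f Z (Pi.single a 1) - Complex.I * fderiv ℝ f Z (Pi.single a Complex.I)) / 2

/-- The Wirtinger derivative `∂f/∂z̄_a = (∂f/∂x_a + i ∂f/∂y_a) / 2`. -/
def dzbar (a : Sym2 (Fin n)) (f : Symm n → ℂ) (Z : Symm n) : ℂ :=
  (fderiv ℝ f Z (Pi.single a 1) + Complex.I * fderiv ℝ f Z (Pi.single a Complex.I)) / 2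

/-- The Hermitian form `c ∑_{a, b} ∂² log K(Z, Z) / ∂z_a ∂z̄_b dz_a ⊗ dz̄_b` at the point `Z`,
evaluated at the tangent vectors `U`, `V`. -/
def logHermitian (c : ℝ) (K : Symm n → Symm n → ℂ) (Z U V : Symm n) : ℂ :=
  c * ∑ a : Sym2 (Fin n), ∑ b : Sym2 (Fin n),
    dz a (dzbar b fun W => Complex.log (K W W)) Z * (U a * conj (V b))

/-- The (normalized) Bergman metric of the Cartan domain of type III, a field of Hermitian forms. -/
def discMetric (n : ℕ) (Z U V : Symm n) : ℂ :=
  logHermitian (1 / (n + 1)) (bergmanKernel (discDomain n) (normMeasure n)) Z U V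

/-- The (normalized) Bergman metric of the Siegel domain, a field of Hermitian forms. -/
def siegelMetric (n : ℕ) (Z U V : Symm n) : ℂ :=
  logHermitian (4 / (n + 1)) (bergmanKernel (siegelDomain n) (normMeasure n)) Z U V

/-- The Riemannian metric `2 Re g` of a field of Hermitian forms `g`. -/
def riemannian (g : Symm n → Symm n → Symm n → ℂ) (Z U V : Symm n) : ℝ := 2 * (g Z U V).re

/-- The associated 2-form `ω = g(J ·, ·)`, where `g` is the Riemannian metric and the complex
structure `J` is multiplication by `i`. -/
def kahlerForm (g : Symm n → Symm n → Symm n → ℂ) (Z U V : Symm n) : ℝ :=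
  riemannian g Z (Complex.I • U) V

/-- The associated 2-form is also `-2 Im g`. -/
theorem kahlerForm_logHermitian (c : ℝ) (K : Symm n → Symm n → ℂ) (Z U V : Symm n) :
    kahlerForm (logHermitian c K) Z U V = -2 * (logHermitian c K Z U V).im := by
  have h : logHermitian c K Z (Complex.I • U) V = Complex.I * logHermitian c K Z U V := by
    simp only [logHermitian, Finset.mul_sum, Pi.smul_apply, smul_eq_mul]
    refine Finset.sum_congr rfl fun a _ => Finset.sum_congr rfl fun b _ => ?_
    ring
  simp [kahlerForm, riemannian, h]

end CartanIII

end

/-! Existence. Integrating a holomorphic function against a rotation-invariant bump of mass one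
returns its value at the centre, so evaluation at Z is an inner product with a mollifier in L².
Projecting the mollifier onto the closure of the Bergman space gives a representer k(Z), and K(Z,W)
= ⟨k(Z), k(W)⟩ is the kernel. The same mean value identity makes k equal locally to its own
convolution with a mollifier, hence smooth, and makes its derivative conjugate-linear. Each element
f of the closure is then a.e. the holomorphic function Z ↦ ⟨k(Z), f⟩, so nothing new was added and
no Montel-type argument is needed.

Diagonal. K(Z,Z) is the squared norm of evaluation at Z. Pulling back along an injective holomorphic
map Φ : D → D' with Jacobian j therefore gives |j(Z)|² K'(ΦZ,ΦZ) ≤ K(Z,Z)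
(`IsBergmanKernel.norm_sq_mul_le`), and a map together with its inverse gives equality. The maps Z ↦
A Z Aᵀ + X act transitively on the Siegel domain with Jacobian (det A)^(n+1) (`det_congrMap`), so
there K(Z,Z) = C det(Im Z)^(-(n+1)). The Cayley transform carries this to C' det(1 - Z Z̄)^(-(n+1))
on the disc. Nonvanishing comes from the constant function 1 on the bounded domain.

Metric. The unknown constants disappear under ∂∂̄ log. Jacobi's formula for log det yields the
traces (`siegel_dz_dzbar`, `disc_dz_dzbar`), the normalizing factors cancel n + 1 and (n + 1)/4, and
the Kähler forms are -2 Im of the metrics. -/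

/-! ### Radial mollifiers and the mean value property -/

section MeanValue

variable {ι : Type*} [Fintype ι]

/-- A smooth mollifier supported in the closed ball of radius `r` and invariant under rotations. -/
structure IsRadialMollifier (μ : Measure (ι → ℂ)) (r : ℝ) (φ : (ι → ℂ) → ℝ) : Prop where
  contDiff : ContDiff ℝ ∞ φ
  eq_zero : ∀ w, r < ‖w‖ → φ w = 0
  integral_eq_one : ∫ w, φ w ∂μ = 1
  rotate : ∀ (c : ℂ) (w : ι → ℂ), ‖c‖ = 1 → φ (c • w) = φ w

namespace IsRadialMollifier

variable {μ : Measure (ι → ℂ)} {r : ℝ} {φ : (ι → ℂ) → ℝ}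

theorem support_subset (h : IsRadialMollifier μ r φ) :
    Function.support φ ⊆ Metric.closedBall 0 r := by
  intro w hw
  by_contra hc
  exact hw (h.eq_zero w (by simpa using hc))

theorem hasCompactSupport (h : IsRadialMollifier μ r φ) : HasCompactSupport φ :=
  .of_support_subset_isCompact (isCompact_closedBall 0 r) h.support_subset

theorem sub_comm (h : IsRadialMollifier μ r φ) (z w : ι → ℂ) : φ (z - w) = φ (w - z) := by
  rw [← h.rotate (-1) (z - w) (by simp)]
  simp

end IsRadialMollifier

/-- The bump depends on ∑ |w i|², which is smooth and rotation-invariant, whereas the sup norm of `ι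
→ ℂ` is not smooth. The sup norm is at most the Euclidean one, so the support still lies in the
sup-norm ball of radius r. -/
theorem exists_isRadialMollifier (μ : Measure (ι → ℂ)) [μ.IsAddHaarMeasure] {r : ℝ} (hr : 0 < r) :
    ∃ φ, IsRadialMollifier μ r φ := by
  let b : ContDiffBump (0 : ℝ) := ⟨r ^ 2 / 2, r ^ 2, by positivity, by nlinarith [sq_pos_of_pos hr]⟩
  let ψ : (ι → ℂ) → ℝ := fun w => b (∑ i, Complex.normSq (w i))
  have hψc : ContDiff ℝ ∞ ψ := by
    refine b.contDiff.comp (ContDiff.sum fun i _ => ?_)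
    simp only [Complex.normSq_apply]
    have h1 : ContDiff ℝ ∞ fun w : ι → ℂ => (w i).re :=
      Complex.reCLM.contDiff.comp (contDiff_apply ℝ ℂ i)
    have h2 : ContDiff ℝ ∞ fun w : ι → ℂ => (w i).im :=
      Complex.imCLM.contDiff.comp (contDiff_apply ℝ ℂ i)
    exact (h1.mul h1).add (h2.mul h2)
  have hψ0 : ∀ w, r < ‖w‖ → ψ w = 0 := by
    intro w hw
    obtain ⟨i, hi⟩ : ∃ i, r < ‖w i‖ := by
      by_contra! hc
      exact absurd hw (not_lt.2 ((pi_norm_le_iff_of_nonneg hr.le).2 hc))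
    apply b.zero_of_le_dist
    have h1 : Complex.normSq (w i) ≤ ∑ i, Complex.normSq (w i) :=
      Finset.single_le_sum (fun j _ => Complex.normSq_nonneg (w j)) (Finset.mem_univ i)
    have h2 : r ^ 2 ≤ Complex.normSq (w i) := by
      rw [Complex.normSq_eq_norm_sq]
      gcongr
    simpa [b, Real.dist_eq] using (h2.trans h1).trans (le_abs_self _)
  have hsupp : HasCompactSupport ψ := by
    refine .of_support_subset_isCompact (isCompact_closedBall 0 r) fun w hw => ?_
    by_contra hc
    exact hw (hψ0 w (by simpa using hc))
  have hpos : 0 < ∫ w, ψ w ∂μ := by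
    refine hψc.continuous.integral_pos_of_hasCompactSupport_nonneg_nonzero hsupp
      (fun w => b.nonneg) (x := 0) ?_
    have : ψ 0 = 1 := by
      simpa [ψ] using b.one_of_mem_closedBall (x := 0) (by simp [b]; positivity)
    simp [this]
  refine ⟨fun w => (∫ w, ψ w ∂μ)⁻¹ * ψ w, contDiff_const.mul hψc, fun w hw => by simp [hψ0 w hw],
    ?_, fun c w hc => ?_⟩
  · rw [integral_const_mul, inv_mul_cancel₀ hpos.ne']
  · simp [ψ, Complex.normSq_eq_norm_sq, hc]

/-- Haar measure on `ℂ^ι` is invariant under multiplication by unimodular scalars. -/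
theorem measurePreserving_rotate (μ : Measure (ι → ℂ)) [μ.IsAddHaarMeasure] {c : ℂ} (hc : ‖c‖ = 1) :
    MeasurePreserving (fun w : ι → ℂ => c • w) μ μ := by
  refine ⟨measurable_const_smul c, ?_⟩
  let f : (ι → ℂ) →ₗ[ℂ] (ι → ℂ) := c • LinearMap.id
  have hdet : |LinearMap.det (f.restrictScalars ℝ)| = 1 := by
    rw [LinearMap.det_restrictScalars, Algebra.norm_complex_apply]
    simp [f, Complex.normSq_eq_norm_sq, hc]
  have h := Measure.map_linearMap_addHaar_eq_smul_addHaar (f := f.restrictScalars ℝ) μ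
    (by intro h0; simp [h0] at hdet)
  rw [abs_inv, hdet] at h
  simpa [f] using! h

/-- Mean value property along a complex line. -/
theorem circleAverage_line_eq {f : (ι → ℂ) → ℂ} {z w : ι → ℂ} {r : ℝ} {D : Set (ι → ℂ)}
    (hD : IsOpen D) (hf : DifferentiableOn ℂ f D) (hz : Metric.closedBall z r ⊆ D) (hw : ‖w‖ ≤ r) :
    Real.circleAverage (fun c : ℂ => f (z + c • w)) 0 1 = f z := by
  have h : DiffContOnCl ℂ (fun c : ℂ => f (z + c • w)) (Metric.ball 0 |1|) := by
    apply DifferentiableOn.diffContOnCl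
    intro c hc
    rw [closure_ball _ (by simp), abs_one, mem_closedBall_zero_iff] at hc
    have hm : z + c • w ∈ D := hz (by
      simp only [Metric.mem_closedBall, dist_self_add_left, norm_smul]
      nlinarith [norm_nonneg w, norm_nonneg c])
    refine ((hf.differentiableAt (hD.mem_nhds hm)).comp c ?_).differentiableWithinAt
    fun_prop
  simpa using h.circleAverage

/-- A holomorphic function is reproduced by radial mollifiers. -/
theorem IsRadialMollifier.integral_mul_eq {μ : Measure (ι → ℂ)} [μ.IsAddHaarMeasure] {r : ℝ}
    {φ : (ι → ℂ) → ℝ} (hφ : IsRadialMollifier μ r φ) {f : (ι → ℂ) → ℂ} {z : ι → ℂ}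
    {D : Set (ι → ℂ)} (hD : IsOpen D) (hf : DifferentiableOn ℂ f D)
    (hz : Metric.closedBall z r ⊆ D) : ∫ w, (φ (w - z) : ℂ) * f w ∂μ = f z := by
  -- For fixed θ the integral over w does not depend on θ, by rotation invariance of φ and μ. For
  -- fixed w the mean over θ is φ(w) f(z), by the mean value property on a complex line. Fubini
  -- equates the two.
  let g : ℝ → (ι → ℂ) → ℂ := fun θ w => (φ w : ℂ) * f (z + circleMap 0 1 θ • w)
  have h1 : ∀ θ, ∫ w, g θ w ∂μ = ∫ w, (φ (w - z) : ℂ) * f w ∂μ := by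
    intro θ
    have hn : ‖circleMap 0 1 θ‖ = 1 := by simp
    have e : MeasurableEmbedding fun w : ι → ℂ => circleMap 0 1 θ • w :=
      (Homeomorph.smulOfNeZero (circleMap 0 1 θ) (by
        intro h0; simp [h0] at hn)).measurableEmbedding
    rw [← integral_add_left_eq_self (fun w => (φ (w - z) : ℂ) * f w) z]
    simp only [g, add_sub_cancel_left]
    rw [← (measurePreserving_rotate μ hn).integral_comp e fun w => (φ w : ℂ) * f (z + w)]
    simp only [hφ.rotate _ _ hn]
  have h2 : ∀ w, (2 * Real.pi)⁻¹ • ∫ θ in (0 : ℝ)..2 * Real.pi, g θ w = (φ w : ℂ) * f z := by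
    intro w
    by_cases hw : ‖w‖ ≤ r
    · rw [← circleAverage_line_eq hD hf hz hw, Real.circleAverage_def]
      simp only [g, intervalIntegral.integral_const_mul, Complex.real_smul]
      ring
    · simp [g, hφ.eq_zero w (not_le.1 hw)]
  have hint : Integrable (Function.uncurry g)
      ((volume.restrict (Set.Ioc 0 (2 * Real.pi))).prod μ) := by
    have hsub : Integrable (Function.uncurry g)
        ((volume.restrict (Set.Icc 0 (2 * Real.pi))).prod (μ.restrict (Metric.closedBall 0 r))) := by
      rw [Measure.prod_restrict]
      refine ContinuousOn.integrableOn_compact (isCompact_Icc.prod (isCompact_closedBall 0 r)) ?_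
      refine ContinuousOn.mul ?_ (hf.continuousOn.comp ?_ ?_)
      · exact (Complex.continuous_ofReal.comp
          (hφ.contDiff.continuous.comp continuous_snd)).continuousOn
      · have := continuous_circleMap 0 1
        fun_prop
      · rintro ⟨θ, w⟩ ⟨-, hw⟩
        apply hz
        simpa [norm_smul] using hw
    have h3 : Integrable (Function.uncurry g)
        ((volume.restrict (Set.Ioc 0 (2 * Real.pi))).prod (μ.restrict (Metric.closedBall 0 r))) := by
      refine hsub.mono_measure ?_
      exact Measure.prod_mono (Measure.restrict_mono Set.Ioc_subset_Icc_self le_rfl) le_rfl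
    rw [← Measure.restrict_univ (μ := volume.restrict _), Measure.prod_restrict] at h3
    rw [← Measure.restrict_univ (μ := volume.restrict (Set.Ioc _ _)),
      ← Measure.restrict_univ (μ := μ), Measure.prod_restrict]
    refine IntegrableOn.of_forall_sdiff_eq_zero h3 (by measurability) ?_
    rintro ⟨θ, w⟩ ⟨-, hw⟩
    have : r < ‖w‖ := by simpa using hw
    simp [g, hφ.eq_zero w this]
  have h3 : ∫ θ in (0 : ℝ)..2 * Real.pi, ∫ w, g θ w ∂μ
      = ∫ w, (∫ θ in (0 : ℝ)..2 * Real.pi, g θ w) ∂μ := by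
    simp only [intervalIntegral.integral_of_le Real.two_pi_pos.le]
    exact integral_integral_swap hint
  have h4 : (2 * Real.pi)⁻¹ • ∫ θ in (0 : ℝ)..2 * Real.pi, ∫ w, g θ w ∂μ = f z := by
    rw [h3, ← integral_smul]
    simp only [h2]
    rw [integral_mul_const, integral_complex_ofReal, hφ.integral_eq_one]
    simp
  rw [← h4]
  simp only [h1, intervalIntegral.integral_const, sub_zero, smul_smul]
  rw [inv_mul_cancel₀ Real.two_pi_pos.ne', one_smul]

end MeanValue

/-! ### Weak antiholomorphy implies smoothness -/

section WeaklyAntiholomorphic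

variable {ι : Type*} [Fintype ι] {V : Type*} [NormedAddCommGroup V] [InnerProductSpace ℂ V]

/-- A continuous family `k` of vectors such that `z ↦ ⟪k z, f⟫` is holomorphic for a
separating set of vectors `f`. -/
structure IsWeaklyAntiholomorphic (D : Set (ι → ℂ)) (k : (ι → ℂ) → V) : Prop where
  continuousOn : ContinuousOn k D
  separating : ∀ x y : V, (∀ f : V, DifferentiableOn ℂ (fun z => inner ℂ (k z) f) D →
    inner ℂ x f = inner ℂ y f) → x = y

namespace IsWeaklyAntiholomorphic

variable {D : Set (ι → ℂ)} {k : (ι → ℂ) → V}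

/-- Near z₀ the family k equals its convolution with a mollifier: tested against a separating
vector, this is the mean value identity. Convolution with a smooth compactly supported function is
smooth. -/
theorem contDiffOn [CompleteSpace V] (hk : IsWeaklyAntiholomorphic D k) (hD : IsOpen D) :
    ContDiffOn ℝ ∞ k D := by
  intro z₀ hz₀
  let μ : Measure (ι → ℂ) := volume
  -- Radius 2r keeps the ball of radius r about every z within r of z₀ inside D.
  obtain ⟨r, hr, hrD⟩ : ∃ r > 0, Metric.closedBall z₀ (2 * r) ⊆ D := by
    obtain ⟨r, hr, hrD⟩ := Metric.nhds_basis_closedBall.mem_iff.1 (hD.mem_nhds hz₀)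
    exact ⟨r / 2, by positivity, by rwa [mul_div_cancel₀ _ two_ne_zero]⟩
  obtain ⟨φ, hφ⟩ := exists_isRadialMollifier μ hr
  refine ContDiffAt.contDiffWithinAt ?_
  set B := Metric.closedBall z₀ (2 * r)
  have hint : Integrable (B.indicator k) μ :=
    ((hk.continuousOn.mono hrD).integrableOn_compact
      (isCompact_closedBall _ _)).integrable_indicator measurableSet_closedBall
  have hsm := hφ.hasCompactSupport.contDiff_convolution_right
    (ContinuousLinearMap.lsmul ℝ ℝ).flip hint.locallyIntegrable hφ.contDiff
  refine hsm.contDiffAt.congr_of_eventuallyEq ?_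
  filter_upwards [Metric.ball_mem_nhds z₀ hr] with z hz
  have hzB : Metric.closedBall z r ⊆ B :=
    Metric.closedBall_subset_closedBall' (by linarith [Metric.mem_ball.1 hz])
  simp only [convolution_def, ContinuousLinearMap.flip_apply, ContinuousLinearMap.lsmul_apply]
  have hint2 : Integrable (fun w => φ (z - w) • B.indicator k w) μ :=
    hφ.hasCompactSupport.convolutionExists_right (ContinuousLinearMap.lsmul ℝ ℝ).flip
      hint.locallyIntegrable hφ.contDiff.continuous z
  refine hk.separating _ _ fun f hg => ?_
  have h1 := hφ.integral_mul_eq hD hg (hzB.trans hrD)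
  rw [← h1, ← inner_conj_symm (∫ w, φ (z - w) • B.indicator k w ∂μ), ← integral_inner hint2,
    ← integral_conj]
  refine integral_congr_ae (.of_forall fun w => ?_)
  simp only [inner_conj_symm]
  by_cases hw : ‖w - z‖ ≤ r
  · have hwB : w ∈ B := hzB (by simpa [dist_eq_norm] using hw)
    rw [Set.indicator_of_mem hwB, hφ.sub_comm, ← Complex.coe_smul, inner_smul_left]
    simp
  · rw [hφ.sub_comm z w, hφ.eq_zero _ (not_le.1 hw)]
    simp

theorem fderiv_mul_I [CompleteSpace V] (hk : IsWeaklyAntiholomorphic D k) (hD : IsOpen D)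
    {z : ι → ℂ} (hz : z ∈ D) (v : ι → ℂ) :
    fderiv ℝ k z (Complex.I • v) = -Complex.I • fderiv ℝ k z v := by
  have hd : DifferentiableAt ℝ k z :=
    ((hk.contDiffOn hD).contDiffAt (hD.mem_nhds hz)).differentiableAt (by simp)
  refine hk.separating _ _ fun f hg => ?_
  have h1 := (hg.differentiableAt (hD.mem_nhds hz)).hasFDerivAt.restrictScalars ℝ
  have h2 : ∀ v, inner ℂ (fderiv ℝ k z v) f = fderiv ℂ (fun z => inner ℂ (k z) f) z v := by
    intro v
    have h3 := hd.hasFDerivAt.inner ℂ (hasFDerivAt_const f z)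
    have h4 := congrArg (fun L => L v) (h3.unique h1)
    simpa using h4
  rw [h2, inner_smul_left, h2]
  simp

/-- Holomorphy passes from the separating vectors to every f: the derivative of k is
conjugate-linear by `fderiv_mul_I`, and the inner product is conjugate-linear in its first slot. -/
theorem differentiableOn_inner [CompleteSpace V] (hk : IsWeaklyAntiholomorphic D k)
    (hD : IsOpen D) (f : V) : DifferentiableOn ℂ (fun z => inner ℂ (k z) f) D := by
  intro z hz
  have hd : DifferentiableAt ℝ k z :=
    ((hk.contDiffOn hD).contDiffAt (hD.mem_nhds hz)).differentiableAt (by simp)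
  have h3 := hd.hasFDerivAt.inner ℂ (hasFDerivAt_const f z)
  let L : (ι → ℂ) →ₗ[ℂ] ℂ :=
    { toFun := fun v => inner ℂ (fderiv ℝ k z v) f
      map_add' := fun v w => by simp
      map_smul' := fun c v => by
        have : c • v = c.re • v + c.im • (Complex.I • v) := by
          ext i
          simp only [Pi.smul_apply, Pi.add_apply, smul_eq_mul, Complex.real_smul]
          nth_rw 1 [← Complex.re_add_im c]
          ring
        rw [this, map_add, map_smul, map_smul, hk.fderiv_mul_I hD hz, inner_add_left,
          ← Complex.coe_smul, ← Complex.coe_smul, inner_smul_left, inner_smul_left,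
          inner_smul_left]
        simp only [Complex.conj_ofReal, map_neg, Complex.conj_I, neg_neg, RingHom.id_apply,
          smul_eq_mul]
        nth_rw 3 [← Complex.re_add_im c]
        ring }
  refine DifferentiableAt.differentiableWithinAt
    (hasFDerivAt_of_restrictScalars (f' := LinearMap.toContinuousLinearMap L) ℝ h3 ?_).differentiableAt
  ext v
  simp [L]

end IsWeaklyAntiholomorphic

end WeaklyAntiholomorphic

/-! ### The Bergman space and its evaluation representers -/

section BergmanSpace

variable {ι : Type*} [Fintype ι]

/-- The Bergman space of `D`, as a subspace of `L²(D, μ)`. -/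
noncomputable def bergmanSpace (D : Set (ι → ℂ)) (μ : Measure (ι → ℂ)) :
    Submodule ℂ (Lp ℂ 2 (μ.restrict D)) where
  carrier := {f | ∃ g : (ι → ℂ) → ℂ, DifferentiableOn ℂ g D ∧ f =ᵐ[μ.restrict D] g}
  add_mem' := by
    rintro f₁ f₂ ⟨g₁, h₁, e₁⟩ ⟨g₂, h₂, e₂⟩
    exact ⟨g₁ + g₂, h₁.add h₂, (Lp.coeFn_add f₁ f₂).trans (e₁.add e₂)⟩
  zero_mem' := ⟨0, differentiableOn_const 0, Lp.coeFn_zero _ _ _⟩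
  smul_mem' := by
    rintro c f ⟨g, h, e⟩
    exact ⟨c • g, h.const_smul c, (Lp.coeFn_smul c f).trans (e.const_smul c)⟩

theorem mem_bergmanSpace {D : Set (ι → ℂ)} {μ : Measure (ι → ℂ)} {f : Lp ℂ 2 (μ.restrict D)} :
    f ∈ bergmanSpace D μ ↔ ∃ g : (ι → ℂ) → ℂ, DifferentiableOn ℂ g D ∧ f =ᵐ[μ.restrict D] g :=
  Iff.rfl

/-- The closure of the Bergman space in `L²(D, μ)`. -/
noncomputable abbrev bergmanClosure (D : Set (ι → ℂ)) (μ : Measure (ι → ℂ)) :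
    Submodule ℂ (Lp ℂ 2 (μ.restrict D)) :=
  (bergmanSpace D μ).topologicalClosure

instance completeSpace_bergmanClosure (D : Set (ι → ℂ)) (μ : Measure (ι → ℂ)) :
    CompleteSpace (bergmanClosure D μ) :=
  (bergmanSpace D μ).isClosed_topologicalClosure.completeSpace_coe

variable {D : Set (ι → ℂ)} {μ : Measure (ι → ℂ)}

theorem bergmanClosure_ext {x y : bergmanClosure D μ}
    (h : ∀ (f : bergmanClosure D μ) (g : (ι → ℂ) → ℂ), DifferentiableOn ℂ g D →
      (f : Lp ℂ 2 (μ.restrict D)) =ᵐ[μ.restrict D] g → inner ℂ x f = inner ℂ y f) : x = y := by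
  rw [← sub_eq_zero]
  have h1 : ((x - y : bergmanClosure D μ) : Lp ℂ 2 (μ.restrict D)) ∈ (bergmanSpace D μ)ᗮ := by
    rw [Submodule.mem_orthogonal']
    intro f hf
    obtain ⟨g, hg, e⟩ := mem_bergmanSpace.1 hf
    have h2 := h ⟨f, Submodule.le_topologicalClosure _ hf⟩ g hg e
    rw [Submodule.coe_sub, inner_sub_left]
    exact sub_eq_zero.2 h2
  rw [← Submodule.orthogonal_closure, Submodule.mem_orthogonal] at h1
  exact inner_self_eq_zero.1 (h1 _ (x - y).2)

/-- `k z` represents the evaluation at `z ∈ D` of functions in the Bergman space. -/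
def IsRepresenter (D : Set (ι → ℂ)) (μ : Measure (ι → ℂ)) (k : (ι → ℂ) → bergmanClosure D μ) :
    Prop :=
  ∀ z ∈ D, ∀ (f : bergmanClosure D μ) (g : (ι → ℂ) → ℂ), DifferentiableOn ℂ g D →
    (f : Lp ℂ 2 (μ.restrict D)) =ᵐ[μ.restrict D] g → inner ℂ (k z) f = g z

/-- An approximating sequence from the Bergman space has an a.e. convergent subsequence, while its
values ⟨k z, u n⟩ converge at every z ∈ D to ⟨k z, f⟩. The limits agree a.e. -/
theorem IsRepresenter.ae_eq_inner {k : (ι → ℂ) → bergmanClosure D μ}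
    (hk : IsRepresenter D μ k) (hD : IsOpen D) (f : bergmanClosure D μ) :
    (f : Lp ℂ 2 (μ.restrict D)) =ᵐ[μ.restrict D] fun z => inner ℂ (k z) f := by
  obtain ⟨u, hu, hlim⟩ := mem_closure_iff_seq_limit.1 f.2
  choose g hg e using hu
  have hle := fun n => Submodule.le_topologicalClosure (bergmanSpace D μ)
    (mem_bergmanSpace.2 ⟨g n, hg n, e n⟩)
  have hlim' : Filter.Tendsto (fun n => (⟨u n, hle n⟩ : bergmanClosure D μ)) Filter.atTop
      (nhds f) := tendsto_subtype_rng.2 hlim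
  obtain ⟨s, hs, hae⟩ := (tendstoInMeasure_of_tendsto_Lp hlim).exists_seq_tendsto_ae
  filter_upwards [hae, ae_all_iff.2 e, ae_restrict_mem hD.measurableSet] with z h1 h2 hz
  refine tendsto_nhds_unique h1 ?_
  have h3 : Filter.Tendsto (fun n => inner ℂ (k z) (⟨u n, hle n⟩ : bergmanClosure D μ))
      Filter.atTop (nhds (inner ℂ (k z) f)) := tendsto_const_nhds.inner hlim'
  refine (h3.comp hs.tendsto_atTop).congr fun n => ?_
  simp only [Function.comp]
  rw [hk z hz _ (g (s n)) (hg _) (e _), h2]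

variable [μ.IsAddHaarMeasure] {r : ℝ} {φ : (ι → ℂ) → ℝ}

theorem IsRadialMollifier.memLp (hφ : IsRadialMollifier μ r φ) (z : ι → ℂ) :
    MemLp (fun w => (φ (w - z) : ℂ)) 2 (μ.restrict D) := by
  refine MemLp.restrict _ (Continuous.memLp_of_hasCompactSupport ?_ ?_)
  · exact Complex.continuous_ofReal.comp (hφ.contDiff.continuous.comp (continuous_sub_right z))
  · exact HasCompactSupport.comp_left (g := ((↑) : ℝ → ℂ))
      (hφ.hasCompactSupport.comp_homeomorph (Homeomorph.subRight z)) Complex.ofReal_zero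

/-- The translate of a mollifier, as an element of `L²(D, μ)`. -/
noncomputable def mollifierLp (D : Set (ι → ℂ)) (hφ : IsRadialMollifier μ r φ) (z : ι → ℂ) :
    Lp ℂ 2 (μ.restrict D) :=
  (hφ.memLp (D := D) z).toLp _

theorem inner_mollifierLp (hφ : IsRadialMollifier μ r φ) (hD : IsOpen D) {z : ι → ℂ}
    (hz : Metric.closedBall z r ⊆ D) {f : Lp ℂ 2 (μ.restrict D)} {g : (ι → ℂ) → ℂ}
    (hg : DifferentiableOn ℂ g D) (hfg : f =ᵐ[μ.restrict D] g) :
    inner ℂ (mollifierLp D hφ z) f = g z := by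
  rw [L2.inner_def, ← hφ.integral_mul_eq hD hg hz,
    ← setIntegral_eq_integral_of_forall_compl_eq_zero (s := D)
      (f := fun w => (φ (w - z) : ℂ) * g w)]
  · refine integral_congr_ae ?_
    filter_upwards [hfg, (hφ.memLp (D := D) z).coeFn_toLp] with w h1 h2
    rw [h1, mollifierLp, h2]
    simp [mul_comm]
  · intro w hw
    have : r < ‖w - z‖ := by
      by_contra hc
      exact hw (hz (by simpa [dist_eq_norm] using hc))
    simp [hφ.eq_zero _ this]

/-- The mollifier is Lipschitz and nearby translates live in one ball of finite measure, so their L²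
distance is O(‖z - z₀‖). -/
theorem continuous_mollifierLp (hφ : IsRadialMollifier μ r φ) :
    Continuous (mollifierLp D hφ) := by
  obtain ⟨C, hC⟩ := ContDiff.lipschitzWith_of_hasCompactSupport (𝕂 := ℝ) hφ.hasCompactSupport
    hφ.contDiff (by simp)
  rw [continuous_iff_continuousAt]
  intro z₀
  rw [ContinuousAt, tendsto_iff_norm_sub_tendsto_zero]
  set B := Metric.closedBall z₀ (r + 1)
  have hB : μ B ≠ ⊤ := (isCompact_closedBall _ _).measure_lt_top.ne
  set A : ℝ := (μ B ^ (1 / (2 : ENNReal).toReal)).toReal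
  have hbound : ∀ᶠ z in nhds z₀, ‖mollifierLp D hφ z - mollifierLp D hφ z₀‖
      ≤ C * ‖z - z₀‖ * A := by
    filter_upwards [Metric.ball_mem_nhds z₀ one_pos] with z hz
    have hsupp : ∀ z', dist z' z₀ ≤ 1 → (fun w => (φ (w - z') : ℂ)).support ⊆ B := by
      intro z' hz' w hw
      have h1 : ‖w - z'‖ ≤ r := by
        by_contra hc
        exact hw (by simp [hφ.eq_zero _ (not_le.1 hc)])
      calc dist w z₀ ≤ dist w z' + dist z' z₀ := dist_triangle _ _ _
        _ ≤ r + 1 := add_le_add (by rwa [dist_eq_norm]) hz'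
    rw [mollifierLp, mollifierLp, ← MemLp.toLp_sub, Lp.norm_toLp]
    have h1 : eLpNorm ((fun w => (φ (w - z) : ℂ)) - fun w => (φ (w - z₀) : ℂ)) 2 (μ.restrict D)
        ≤ ENNReal.ofReal (C * ‖z - z₀‖) * μ B ^ (1 / (2 : ENNReal).toReal) := by
      refine (eLpNorm_mono_measure _ Measure.restrict_le_self).trans
        (eLpNorm_sub_le_of_dist_bdd μ (by simp) measurableSet_closedBall (by positivity)
          (fun w => ?_) (hsupp z hz.le) (hsupp z₀ (by simp)))
      rw [Complex.dist_eq, ← Complex.ofReal_sub, Complex.norm_real, ← dist_eq_norm]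
      refine (hC.dist_le_mul _ _).trans_eq ?_
      rw [dist_sub_left, dist_eq_norm]
    have h2 := ENNReal.toReal_mono (by finiteness) h1
    rwa [ENNReal.toReal_mul, ENNReal.toReal_ofReal (by positivity)] at h2
  refine squeeze_zero' (.of_forall fun _ => norm_nonneg _) hbound ?_
  have : Continuous fun z => C * ‖z - z₀‖ * A := by fun_prop
  simpa using this.tendsto z₀

theorem exists_isRepresenter (hD : IsOpen D) : ∃ k, IsRepresenter D μ k := by
  have h : ∀ z, ∃ k : bergmanClosure D μ, z ∈ D → ∀ (f : bergmanClosure D μ) (g : (ι → ℂ) → ℂ),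
      DifferentiableOn ℂ g D → (f : Lp ℂ 2 (μ.restrict D)) =ᵐ[μ.restrict D] g →
      inner ℂ k f = g z := by
    intro z
    by_cases hz : z ∈ D
    · obtain ⟨r, hr, hrD⟩ := Metric.nhds_basis_closedBall.mem_iff.1 (hD.mem_nhds hz)
      obtain ⟨φ, hφ⟩ := exists_isRadialMollifier μ hr
      refine ⟨(bergmanClosure D μ).orthogonalProjectionOnto (mollifierLp D hφ z),
        fun _ f g hg e => ?_⟩
      rw [Submodule.inner_orthogonalProjectionOnto_eq_of_mem_right]
      exact inner_mollifierLp hφ hD hrD hg e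
    · exact ⟨0, fun h => absurd h hz⟩
  choose k hk using h
  exact ⟨k, hk⟩

namespace IsRepresenter

variable {k : (ι → ℂ) → bergmanClosure D μ}

/-- Representers are unique on D, so one mollifier of fixed radius serves all points near a given
one. Continuity of k follows, although k was chosen point by point. -/
theorem eq_projection (hk : IsRepresenter D μ k) (hD : IsOpen D) (hφ : IsRadialMollifier μ r φ)
    {z : ι → ℂ} (hr : 0 ≤ r) (hz : Metric.closedBall z r ⊆ D) :
    k z = (bergmanClosure D μ).orthogonalProjectionOnto (mollifierLp D hφ z) := by
  refine bergmanClosure_ext fun f g hg e => ?_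
  rw [hk z (hz (Metric.mem_closedBall_self hr)) f g hg e,
    Submodule.inner_orthogonalProjectionOnto_eq_of_mem_right, inner_mollifierLp hφ hD hz hg e]

theorem exists_closedBall (hD : IsOpen D) {z₀ : ι → ℂ} (hz₀ : z₀ ∈ D) :
    ∃ r > 0, Metric.closedBall z₀ (2 * r) ⊆ D := by
  obtain ⟨r, hr, hrD⟩ := Metric.nhds_basis_closedBall.mem_iff.1 (hD.mem_nhds hz₀)
  exact ⟨r / 2, by positivity, by rwa [mul_div_cancel₀ _ two_ne_zero]⟩

theorem continuousOn (hk : IsRepresenter D μ k) (hD : IsOpen D) : ContinuousOn k D := by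
  intro z₀ hz₀
  obtain ⟨r, hr, hrD⟩ := exists_closedBall hD hz₀
  obtain ⟨φ, hφ⟩ := exists_isRadialMollifier μ hr
  refine ContinuousAt.continuousWithinAt ?_
  have h1 : Continuous fun z =>
      (bergmanClosure D μ).orthogonalProjectionOnto (mollifierLp D hφ z) :=
    (ContinuousLinearMap.continuous _).comp (continuous_mollifierLp hφ)
  refine h1.continuousAt.congr ?_
  filter_upwards [Metric.ball_mem_nhds z₀ hr] with z hz
  refine (hk.eq_projection hD hφ hr.le (subset_trans ?_ hrD)).symm
  exact Metric.closedBall_subset_closedBall' (by linarith [Metric.mem_ball.1 hz])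

theorem isWeaklyAntiholomorphic (hk : IsRepresenter D μ k) (hD : IsOpen D) :
    IsWeaklyAntiholomorphic D k where
  continuousOn := hk.continuousOn hD
  separating _ _ h := bergmanClosure_ext fun f g hg e =>
    h f (hg.congr fun z hz => hk z hz f g hg e)

end IsRepresenter

end BergmanSpace

/-! ### Inner products and norms in L² as integrals -/

section L2

variable {α : Type*} [MeasurableSpace α] {μ : Measure α} {f g : α → ℂ}

theorem inner_toLp_toLp (hf : MemLp f 2 μ) (hg : MemLp g 2 μ) :
    inner ℂ (hf.toLp f) (hg.toLp g) = ∫ a, g a * conj (f a) ∂μ := by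
  rw [L2.inner_def]
  refine integral_congr_ae ?_
  filter_upwards [hf.coeFn_toLp, hg.coeFn_toLp] with a h1 h2
  rw [h1, h2]
  simp

theorem norm_toLp_sq (hf : MemLp f 2 μ) : ‖hf.toLp f‖ ^ 2 = ∫ a, ‖f a‖ ^ 2 ∂μ := by
  have h := inner_toLp_toLp hf hf
  simp only [inner_self_eq_norm_sq_to_K, Complex.mul_conj'] at h
  have h2 : (((∫ a, ‖f a‖ ^ 2 ∂μ : ℝ)) : ℂ) = ∫ a, (‖f a‖ : ℂ) ^ 2 ∂μ := by
    rw [← integral_complex_ofReal]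
    simp
  rw [← h2] at h
  refine Complex.ofReal_injective (Eq.trans ?_ h)
  push_cast
  rfl

theorem norm_integral_mul_sq_le (hf : MemLp f 2 μ) (hg : MemLp g 2 μ) :
    ‖∫ a, g a * conj (f a) ∂μ‖ ^ 2 ≤ (∫ a, ‖f a‖ ^ 2 ∂μ) * ∫ a, ‖g a‖ ^ 2 ∂μ := by
  rw [← inner_toLp_toLp hf hg, ← norm_toLp_sq hf, ← norm_toLp_sq hg, ← mul_pow]
  gcongr
  exact norm_inner_le_norm _ _

end L2

/-! ### Existence, reproducing property and monotonicity of Bergman kernels -/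

namespace CartanIII

variable {n : ℕ} {D : Set (Symm n)} {μ : Measure (Symm n)} {K : Symm n → Symm n → ℂ}

theorem exists_isBergmanKernel (hD : IsOpen D) (μ : Measure (Symm n)) [μ.IsAddHaarMeasure] :
    ∃ K, IsBergmanKernel D μ K := by
  obtain ⟨k, hk⟩ := exists_isRepresenter (μ := μ) hD
  have hw := hk.isWeaklyAntiholomorphic hD
  have hmem : ∀ f : bergmanClosure D μ, MemBergman D μ fun Z => inner ℂ (k Z) f := fun f =>
    ⟨hw.differentiableOn_inner hD f, (Lp.memLp f.1).ae_eq (hk.ae_eq_inner hD f)⟩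
  -- The inner product is conjugate-linear in the first slot and k is antiholomorphic, so this is
  -- holomorphic in Z and antiholomorphic in W. As a function of W, k(Z) is ⟨k W, k Z⟩, so the
  -- integral of f against the kernel is ⟨k Z, f⟩ = ⟨k Z, Pf⟩.
  refine ⟨fun Z W => inner ℂ (k Z) (k W), ?_, fun W _ => (hmem (k W)).1, fun Z _ => ?_, ?_⟩
  · exact ContDiffOn.inner ℂ ((hw.contDiffOn hD).comp contDiffOn_fst fun p hp => hp.1)
      ((hw.contDiffOn hD).comp contDiffOn_snd fun p hp => hp.2)
  · have h : (fun W => conj (inner ℂ (k Z) (k W))) = fun W => inner ℂ (k W) (k Z) :=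
      funext fun W => inner_conj_symm (k W) (k Z)
    rw [h]
    exact hmem (k Z)
  · intro f hf
    let Pf := (bergmanClosure D μ).orthogonalProjectionOnto (hf.toLp f)
    have hh : (fun Z => ∫ W in D, f W * inner ℂ (k Z) (k W) ∂μ)
        = fun Z => inner ℂ (k Z) Pf := by
      funext Z
      rw [Submodule.inner_orthogonalProjectionOnto_eq_of_mem_left, L2.inner_def]
      refine integral_congr_ae ?_
      filter_upwards [hf.coeFn_toLp, hk.ae_eq_inner hD (k Z)] with W h1 h2
      rw [h1, h2, ← inner_conj_symm (k Z) (k W)]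
      simp
    rw [hh]
    refine ⟨hmem Pf, fun φ hφ => ?_⟩
    have hφm : hφ.2.toLp φ ∈ bergmanClosure D μ :=
      Submodule.le_topologicalClosure _ (mem_bergmanSpace.2 ⟨φ, hφ.1, hφ.2.coeFn_toLp⟩)
    have h0 : inner ℂ (hφ.2.toLp φ) (hf.toLp f - (Pf : Lp ℂ 2 (μ.restrict D))) = 0 :=
      Submodule.sub_starProjection_mem_orthogonal (K := bergmanClosure D μ) (hf.toLp f) _ hφm
    rw [← h0, L2.inner_def]
    refine integral_congr_ae ?_
    filter_upwards [hf.coeFn_toLp, hφ.2.coeFn_toLp, hk.ae_eq_inner hD Pf,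
      Lp.coeFn_sub (hf.toLp f) (Pf : Lp ℂ 2 (μ.restrict D))] with W h1 h2 h3 h4
    rw [h4, Pi.sub_apply, h1, h2, h3]
    simp

theorem isBergmanKernel_bergmanKernel (hD : IsOpen D) (μ : Measure (Symm n))
    [μ.IsAddHaarMeasure] : IsBergmanKernel D μ (bergmanKernel D μ) :=
  Classical.epsilon_spec (exists_isBergmanKernel hD μ)

theorem IsBergmanKernel.memLp (hK : IsBergmanKernel D μ K) {Z : Symm n} (hZ : Z ∈ D) :
    MemLp (fun W => conj (K Z W)) 2 (μ.restrict D) :=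
  (hK.conj_mem Z hZ).2

/-- The reproducing property. -/
theorem IsBergmanKernel.integral_mul_eq [μ.IsOpenPosMeasure] (hK : IsBergmanKernel D μ K)
    (hD : IsOpen D) {f : Symm n → ℂ} (hf : MemBergman D μ f) {Z : Symm n} (hZ : Z ∈ D) :
    ∫ W in D, f W * K Z W ∂μ = f Z := by
  obtain ⟨hh, ho⟩ := hK.projection f hf.2
  set h := fun Z => ∫ W in D, f W * K Z W ∂μ
  -- The difference lies in the Bergman space and is orthogonal to it, hence to itself. Continuity
  -- turns a.e. vanishing into vanishing at Z.
  have hd : MemBergman D μ (fun W => f W - h W) := ⟨hf.1.sub hh.1, hf.2.sub hh.2⟩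
  have h1 := norm_toLp_sq hd.2
  have h2 := inner_toLp_toLp hd.2 hd.2
  rw [ho _ hd, inner_self_eq_zero] at h2
  have h3 : h =ᵐ[μ.restrict D] f := by
    have h4 := hd.2.coeFn_toLp
    rw [h2] at h4
    filter_upwards [h4, Lp.coeFn_zero ℂ 2 (μ.restrict D)] with W h5 h6
    rw [h6, Pi.zero_apply] at h5
    exact (sub_eq_zero.1 h5.symm).symm
  exact Measure.eqOn_open_of_ae_eq h3 hD hh.1.continuousOn hf.1.continuousOn hZ

/-- The reproducing property applied to conj K(Z,·) itself. -/
theorem IsBergmanKernel.diag_eq [μ.IsOpenPosMeasure] (hK : IsBergmanKernel D μ K)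
    (hD : IsOpen D) {Z : Symm n} (hZ : Z ∈ D) :
    K Z Z = ((∫ W in D, ‖K Z W‖ ^ 2 ∂μ : ℝ) : ℂ) := by
  have h := hK.integral_mul_eq hD (hK.conj_mem Z hZ) hZ
  simp only [Complex.conj_mul'] at h
  rw [← Complex.conj_conj (K Z Z), ← h, ← integral_conj, ← integral_complex_ofReal]
  simp

theorem IsBergmanKernel.diag_eq_norm [μ.IsOpenPosMeasure] (hK : IsBergmanKernel D μ K)
    (hD : IsOpen D) {Z : Symm n} (hZ : Z ∈ D) : K Z Z = (‖K Z Z‖ : ℂ) := by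
  have h := hK.diag_eq hD hZ
  have h0 : 0 ≤ ∫ W in D, ‖K Z W‖ ^ 2 ∂μ := integral_nonneg fun _ => by positivity
  rw [h, Complex.norm_real, Real.norm_of_nonneg h0]

/-- Cauchy–Schwarz in the reproducing formula. This extremal property of the diagonal is what makes
kernels of different domains comparable. -/
theorem IsBergmanKernel.norm_sq_le [μ.IsOpenPosMeasure] (hK : IsBergmanKernel D μ K)
    (hD : IsOpen D) {f : Symm n → ℂ} (hf : MemBergman D μ f) {Z : Symm n} (hZ : Z ∈ D) :
    ‖f Z‖ ^ 2 ≤ ‖K Z Z‖ * ∫ W in D, ‖f W‖ ^ 2 ∂μ := by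
  have h := norm_integral_mul_sq_le (hK.memLp hZ) hf.2
  simp only [Complex.conj_conj, RCLike.norm_conj] at h
  rw [hK.integral_mul_eq hD hf hZ] at h
  have h0 : 0 ≤ ∫ W in D, ‖K Z W‖ ^ 2 ∂μ := integral_nonneg fun _ => by positivity
  rwa [hK.diag_eq hD hZ, Complex.norm_real, Real.norm_of_nonneg h0]

/-- The Bergman kernels of two domains are related by injective holomorphic maps. -/
theorem IsBergmanKernel.norm_sq_mul_le [μ.IsAddHaarMeasure] {D' : Set (Symm n)}
    {K' : Symm n → Symm n → ℂ} (hK : IsBergmanKernel D μ K) (hK' : IsBergmanKernel D' μ K')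
    (hD : IsOpen D) (hD' : IsOpen D') {Φ : Symm n → Symm n} {Φ' : Symm n → Symm n →L[ℂ] Symm n}
    {j : Symm n → ℂ} (hΦ : ∀ Z ∈ D, HasFDerivAt Φ (Φ' Z) Z) (hinj : Set.InjOn Φ D)
    (hmaps : Set.MapsTo Φ D D') (hj : DifferentiableOn ℂ j D)
    (hdet : ∀ Z ∈ D, ‖LinearMap.det (Φ' Z : Symm n →ₗ[ℂ] Symm n)‖ = ‖j Z‖)
    {Z : Symm n} (hZ : Z ∈ D) : ‖j Z‖ ^ 2 * ‖K' (Φ Z) (Φ Z)‖ ≤ ‖K Z Z‖ := by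
  -- The extremal function for evaluation at Φ Z, pulled back to F = j · (f ∘ Φ). Change of
  -- variables gives ‖F‖² ≤ ‖f‖² = K'(ΦZ,ΦZ), and the extremal inequality for F at Z gives the claim
  -- after division by K'(ΦZ,ΦZ). Only |j| enters, so j need not equal the Jacobian determinant.
  let f : Symm n → ℂ := fun W => conj (K' (Φ Z) W)
  have hf : MemBergman D' μ f := hK'.conj_mem _ (hmaps hZ)
  let F : Symm n → ℂ := fun W => j W * f (Φ W)
  have hΦR : ∀ W ∈ D, HasFDerivWithinAt Φ ((Φ' W).restrictScalars ℝ) D W := fun W hW =>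
    ((hΦ W hW).restrictScalars ℝ).hasFDerivWithinAt
  have hdetR : ∀ W ∈ D, |((Φ' W).restrictScalars ℝ).det| = ‖j W‖ ^ 2 := by
    intro W hW
    have : ((Φ' W).restrictScalars ℝ).det
        = LinearMap.det ((Φ' W : Symm n →ₗ[ℂ] Symm n).restrictScalars ℝ) := rfl
    rw [this, LinearMap.det_restrictScalars, Algebra.norm_complex_apply,
      Complex.normSq_eq_norm_sq, hdet W hW, abs_of_nonneg (by positivity)]
  have hFd : DifferentiableOn ℂ F D := hj.mul
    (hf.1.comp (fun W hW => (hΦ W hW).differentiableAt.differentiableWithinAt) hmaps)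
  have hfi : IntegrableOn (fun W => ‖f W‖ ^ 2) D' μ :=
    (memLp_two_iff_integrable_sq_norm hf.2.aestronglyMeasurable).1 hf.2
  have himg : Φ '' D ⊆ D' := hmaps.image_subset
  have hFeq : ∀ W ∈ D, |((Φ' W).restrictScalars ℝ).det| • ‖f (Φ W)‖ ^ 2 = ‖F W‖ ^ 2 := by
    intro W hW
    rw [hdetR W hW, norm_mul, mul_pow, smul_eq_mul]
  have hFi : IntegrableOn (fun W => ‖F W‖ ^ 2) D μ := by
    refine (integrableOn_congr_fun hFeq hD.measurableSet).1 ?_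
    exact (integrableOn_image_iff_integrableOn_abs_det_fderiv_smul μ hD.measurableSet hΦR hinj
      fun W => ‖f W‖ ^ 2).1 (hfi.mono_set himg)
  have hF : MemBergman D μ F := ⟨hFd, (memLp_two_iff_integrable_sq_norm
    (hFd.continuousOn.aestronglyMeasurable hD.measurableSet)).2 hFi⟩
  have hint : ∫ W in D, ‖F W‖ ^ 2 ∂μ ≤ ∫ W in D', ‖f W‖ ^ 2 ∂μ := by
    rw [← setIntegral_congr_fun hD.measurableSet hFeq,
      ← integral_image_eq_integral_abs_det_fderiv_smul μ hD.measurableSet hΦR hinj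
        fun W => ‖f W‖ ^ 2]
    exact setIntegral_mono_set hfi (.of_forall fun _ => by positivity) himg.eventuallyLE
  have ha : ∫ W in D', ‖f W‖ ^ 2 ∂μ = ‖K' (Φ Z) (Φ Z)‖ := by
    have h0 : 0 ≤ ∫ W in D', ‖K' (Φ Z) W‖ ^ 2 ∂μ := integral_nonneg fun _ => by positivity
    rw [hK'.diag_eq hD' (hmaps hZ), Complex.norm_real, Real.norm_of_nonneg h0]
    simp [f]
  have hle := hK.norm_sq_le hD hF hZ
  have hFZ : ‖F Z‖ ^ 2 = ‖j Z‖ ^ 2 * ‖K' (Φ Z) (Φ Z)‖ ^ 2 := by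
    simp [F, f, mul_pow]
  rcases (norm_nonneg (K' (Φ Z) (Φ Z))).eq_or_lt with h0 | h0
  · rw [← h0, mul_zero]
    exact norm_nonneg _
  · refine le_of_mul_le_mul_right ?_ h0
    calc ‖j Z‖ ^ 2 * ‖K' (Φ Z) (Φ Z)‖ * ‖K' (Φ Z) (Φ Z)‖ = ‖F Z‖ ^ 2 := by rw [hFZ]; ring
      _ ≤ ‖K Z Z‖ * ∫ W in D, ‖F W‖ ^ 2 ∂μ := hle
      _ ≤ ‖K Z Z‖ * ‖K' (Φ Z) (Φ Z)‖ := by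
        rw [← ha]
        gcongr

end CartanIII

/-! ### The determinant of U ↦ A U Aᵀ on symmetric matrices -/

namespace CartanIII

variable {n : ℕ}

theorem mat_injective : Function.Injective (mat (n := n)) := fun _ W h =>
  (existsUnique_mat_eq (mat_isSymm W)).unique h rfl

/-- The coordinates of the symmetric part of a matrix. -/
noncomputable def ofMat : Matrix (Fin n) (Fin n) ℂ →ₗ[ℂ] Symm n where
  toFun A := Sym2.lift ⟨fun j k => (A j k + A k j) / 2, fun j k => congrArg (· / 2) (add_comm _ _)⟩
  map_add' A B := by
    funext p
    induction p with
    | _ j k => simp only [Sym2.lift_mk, Matrix.add_apply, Pi.add_apply]; ring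
  map_smul' c A := by
    funext p
    induction p with
    | _ j k => simp only [Sym2.lift_mk, Matrix.smul_apply, Pi.smul_apply, smul_eq_mul,
        RingHom.id_apply]; ring

/-- The symmetric matrix with given coordinates, as a linear map. -/
noncomputable def matL : Symm n →ₗ[ℂ] Matrix (Fin n) (Fin n) ℂ where
  toFun := mat
  map_add' _ _ := rfl
  map_smul' _ _ := rfl

@[simp] theorem matL_apply (Z : Symm n) : matL Z = mat Z := rfl

theorem mat_ofMat {A : Matrix (Fin n) (Fin n) ℂ} (hA : A.IsSymm) : mat (ofMat A) = A := by
  ext j k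
  simp [mat, ofMat, hA.apply j k]

/-- The linear map `U ↦ A U Aᵀ` of symmetric matrices. -/
noncomputable def congrMap (A : Matrix (Fin n) (Fin n) ℂ) : Symm n →ₗ[ℂ] Symm n :=
  ofMat ∘ₗ LinearMap.mulLeft ℂ A ∘ₗ LinearMap.mulRight ℂ A.transpose ∘ₗ matL

theorem congrMap_apply (A : Matrix (Fin n) (Fin n) ℂ) (U : Symm n) :
    congrMap A U = ofMat (A * mat U * A.transpose) := by
  simp [congrMap, mul_assoc]

theorem isSymm_mul_mul_transpose {A B : Matrix (Fin n) (Fin n) ℂ} (hB : B.IsSymm) :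
    (A * B * A.transpose).IsSymm := by
  rw [Matrix.IsSymm, Matrix.transpose_mul, Matrix.transpose_mul, Matrix.transpose_transpose,
    hB.eq, mul_assoc]

theorem mat_congrMap (A : Matrix (Fin n) (Fin n) ℂ) (U : Symm n) :
    mat (congrMap A U) = A * mat U * A.transpose := by
  rw [congrMap_apply, mat_ofMat (isSymm_mul_mul_transpose (mat_isSymm U))]

theorem congrMap_mul (A B : Matrix (Fin n) (Fin n) ℂ) :
    congrMap (A * B) = congrMap A ∘ₗ congrMap B := by
  refine LinearMap.ext fun U => mat_injective ?_
  simp only [LinearMap.comp_apply, mat_congrMap, Matrix.transpose_mul, mul_assoc]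

theorem congrMap_one : congrMap (1 : Matrix (Fin n) (Fin n) ℂ) = LinearMap.id := by
  refine LinearMap.ext fun U => mat_injective ?_
  simp [mat_congrMap]

/-- A multiplicative function of matrices over `ℂ` is trivial on transvections. -/
theorem map_transvection_eq_one {ι : Type*} [Fintype ι] [DecidableEq ι]
    (χ : Matrix ι ι ℂ →* ℂ) {i j : ι} (hij : i ≠ j) (c : ℂ) :
    χ (Matrix.transvection i j c) = 1 := by
  have hunit : ∀ A : Matrix ι ι ℂ, A.det ≠ 0 → χ A ≠ 0 := fun A hA =>
    (((Matrix.isUnit_iff_isUnit_det A).2 hA.isUnit).map χ).ne_zero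
  -- Conjugation by this diagonal matrix doubles c, that is, squares the transvection T. Hence χ(T)
  -- = χ(T)², and χ(T) ≠ 0.
  let d : ι → ℂ := Function.update 1 i 2
  have hd : (Matrix.diagonal d).det ≠ 0 := by
    rw [Matrix.det_diagonal, Finset.prod_ne_zero_iff]
    intro k _
    by_cases hk : k = i <;> simp [d, hk]
  have hT : (Matrix.transvection i j c).det ≠ 0 := by
    rw [Matrix.det_transvection_of_ne i j hij]; exact one_ne_zero
  have h : Matrix.diagonal d * Matrix.transvection i j c
      = Matrix.transvection i j c * Matrix.transvection i j c * Matrix.diagonal d := by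
    rw [Matrix.transvection_mul_transvection_same _ _ hij]
    simp only [Matrix.transvection, mul_add, add_mul, mul_one, one_mul]
    congr 1
    ext a b
    rw [Matrix.diagonal_mul, Matrix.mul_diagonal, Matrix.single_apply, Matrix.single_apply]
    split_ifs with hab
    · obtain ⟨rfl, rfl⟩ := hab
      simp [d, hij.symm]
      ring
    · simp
  have h2 := congrArg χ h
  simp only [map_mul] at h2
  have h3 : χ (Matrix.diagonal d) * χ (Matrix.transvection i j c) * 1
      = χ (Matrix.diagonal d) * χ (Matrix.transvection i j c) * χ (Matrix.transvection i j c) := by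
    linear_combination h2
  exact (mul_left_cancel₀ (mul_ne_zero (hunit _ hd) (hunit _ hT)) h3).symm

/-- Inserting a adds the pairs s(a, b) with b in the enlarged set; they contribute d a to the power
card s + 2 and each old d b once more. -/
theorem prod_sym2_mul {ι : Type*} [DecidableEq ι] (d : ι → ℂ) (s : Finset ι) :
    ∏ p ∈ s.sym2, (p.map d).mul = (∏ i ∈ s, d i) ^ (s.card + 1) := by
  induction s using Finset.induction_on with
  | empty => simp
  | insert a s ha ih =>
    have hdisj : Disjoint ((insert a s).image fun b => s(a, b)) s.sym2 := by
      rw [Finset.disjoint_left]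
      intro p hp hps
      obtain ⟨b, -, rfl⟩ := Finset.mem_image.1 hp
      exact ha (Finset.mk_mem_sym2_iff.1 hps).1
    rw [Finset.sym2_insert, Finset.prod_union hdisj, ih,
      Finset.prod_image fun b _ c _ h => Sym2.congr_right.1 h]
    simp only [Sym2.map_mk, Sym2.mul_mk]
    rw [Finset.prod_mul_distrib, Finset.prod_const, Finset.card_insert_of_notMem ha,
      Finset.prod_insert ha]
    ring

theorem det_congrMap_diagonal (d : Fin n → ℂ) :
    LinearMap.det (congrMap (Matrix.diagonal d)) = (Matrix.diagonal d).det ^ (n + 1) := by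
  have h : congrMap (Matrix.diagonal d)
      = Matrix.toLin' (Matrix.diagonal fun p : Sym2 (Fin n) => (p.map d).mul) := by
    refine LinearMap.ext fun U => mat_injective ?_
    ext j k
    rw [mat_congrMap]
    simp [mat, Matrix.mulVec_diagonal]
    ring
  rw [h, LinearMap.det_toLin', Matrix.det_diagonal, Matrix.det_diagonal]
  have := prod_sym2_mul d Finset.univ
  rwa [Finset.card_univ, Fintype.card_fin, Finset.sym2_univ] at this

/-- Both sides are multiplicative in A, and diagonal matrices and transvections generate. On a
diagonal matrix the map scales the coordinate s(j, k) by d j · d k. -/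
theorem det_congrMap (A : Matrix (Fin n) (Fin n) ℂ) :
    LinearMap.det (congrMap A) = A.det ^ (n + 1) := by
  let χ : Matrix (Fin n) (Fin n) ℂ →* ℂ :=
    { toFun := fun A => LinearMap.det (congrMap A)
      map_one' := by rw [congrMap_one, LinearMap.det_id]
      map_mul' := fun A B => by rw [congrMap_mul, LinearMap.det_comp] }
  refine Matrix.diagonal_transvection_induction
    (fun A => LinearMap.det (congrMap A) = A.det ^ (n + 1)) A ?_ ?_ ?_
  · exact fun d _ => det_congrMap_diagonal d
  · intro t
    rw [Matrix.TransvectionStruct.toMatrix, Matrix.det_transvection_of_ne _ _ t.hij, one_pow]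
    exact map_transvection_eq_one χ t.hij t.c
  · intro A B hA hB
    rw [congrMap_mul, LinearMap.det_comp, hA, hB, Matrix.det_mul, mul_pow]

end CartanIII

/-! ### Derivatives of determinants, inverses and traces -/

section MatrixCalculus

attribute [local instance] Matrix.linftyOpNormedRing Matrix.linftyOpNormedAlgebra

variable {m : Type*} [Fintype m] [DecidableEq m]

theorem differentiable_det : Differentiable ℂ fun A : Matrix m m ℂ => A.det := by
  simp only [Matrix.det_apply']
  have h : ∀ i j : m, Differentiable ℂ fun A : Matrix m m ℂ => A i j := fun i j =>
    (LinearMap.toContinuousLinearMap (Matrix.entryLinearMap ℂ ℂ i j)).differentiable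
  fun_prop

/-- Jacobi's formula: after factoring out A, the linear coefficient of det(1 + t A⁻¹H) is a trace.
-/
theorem hasDerivAt_det_add_smul {A : Matrix m m ℂ} (hA : A.det ≠ 0) (H : Matrix m m ℂ) :
    HasDerivAt (fun t : ℂ => (A + t • H).det) (A.det * (A⁻¹ * H).trace) 0 := by
  have hu : IsUnit A.det := hA.isUnit
  let p : Polynomial ℂ := (1 + (Polynomial.X : Polynomial ℂ) • (A⁻¹ * H).map Polynomial.C).det
  have h1 : ∀ t : ℂ, (A + t • H).det = A.det * p.eval t := by
    intro t
    have h2 : A + t • H = A * (1 + t • (A⁻¹ * H)) := by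
      rw [mul_add, mul_one, mul_smul_comm, Matrix.mul_nonsing_inv_cancel_left _ _ hu]
    rw [h2, Matrix.det_mul]
    congr 1
    change _ = (Polynomial.evalRingHom t) p
    rw [RingHom.map_det]
    congr 1
    ext i j
    rw [RingHom.mapMatrix_apply, Matrix.map_apply, Matrix.add_apply, Matrix.add_apply,
      Matrix.smul_apply, Matrix.smul_apply, Matrix.map_apply]
    simp [Matrix.one_apply, apply_ite]
    exact mul_comm _ _
  simp only [h1]
  have h3 := (p.hasDerivAt 0).const_mul A.det
  rwa [Matrix.derivative_det_one_add_X_smul] at h3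

theorem fderiv_det {A : Matrix m m ℂ} (hA : A.det ≠ 0) (H : Matrix m m ℂ) :
    fderiv ℂ (fun A : Matrix m m ℂ => A.det) A H = A.det * (A⁻¹ * H).trace := by
  have h1 : HasDerivAt (fun t : ℂ => A + t • H) H 0 := by
    have h := ((hasDerivAt_id (0 : ℂ)).smul_const H).const_add A
    rwa [one_smul] at h
  have h2 : HasFDerivAt (fun A : Matrix m m ℂ => A.det)
      (fderiv ℂ (fun A : Matrix m m ℂ => A.det) A) (A + (0 : ℂ) • H) := by
    simpa using differentiable_det.differentiableAt.hasFDerivAt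
  exact (h2.comp_hasDerivAt 0 h1).unique (hasDerivAt_det_add_smul hA H)

theorem hasFDerivAt_matrix_inv {A : Matrix m m ℂ} (hA : A.det ≠ 0) :
    HasFDerivAt (fun A : Matrix m m ℂ => A⁻¹)
      (-ContinuousLinearMap.mulLeftRight ℂ (Matrix m m ℂ) A⁻¹ A⁻¹) A := by
  obtain ⟨u, rfl⟩ := (Matrix.isUnit_iff_isUnit_det A).2 hA.isUnit
  have h := hasFDerivAt_ringInverse (𝕜 := ℂ) u
  rw [Matrix.coe_units_inv] at h
  have h2 : (fun A : Matrix m m ℂ => A⁻¹) = Ring.inverse :=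
    funext Matrix.nonsing_inv_eq_ringInverse
  rw [h2]
  exact h

variable {E : Type*} [NormedAddCommGroup E] [NormedSpace ℝ E]

/-- The derivative is taken over ℝ because G will involve complex conjugation; only its values on
the coordinate directions are used later. -/
theorem exists_hasFDerivAt_log_det {G : E → Matrix m m ℂ} {G' : E →L[ℝ] Matrix m m ℂ} {Z : E}
    (hG : HasFDerivAt G G' Z) (hZ : (G Z).det ∈ Complex.slitPlane) :
    ∃ f' : E →L[ℝ] ℂ, HasFDerivAt (fun W => Complex.log (G W).det) f' Z ∧
      ∀ v, f' v = ((G Z)⁻¹ * G' v).trace := by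
  have hne : (G Z).det ≠ 0 := Complex.slitPlane_ne_zero hZ
  have h1 : HasFDerivAt (fun A : Matrix m m ℂ => A.det)
      ((fderiv ℂ (fun A : Matrix m m ℂ => A.det) (G Z)).restrictScalars ℝ) (G Z) :=
    differentiable_det.differentiableAt.hasFDerivAt.restrictScalars ℝ
  have h2 := ((Complex.hasStrictDerivAt_log hZ).hasDerivAt.hasFDerivAt.restrictScalars ℝ).comp Z
    (h1.comp Z hG)
  refine ⟨_, h2, fun v => ?_⟩
  change fderiv ℂ (fun A : Matrix m m ℂ => A.det) (G Z) (G' v) * ((G Z).det)⁻¹ = _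
  rw [fderiv_det hne]
  field_simp

theorem exists_hasFDerivAt_inv {G : E → Matrix m m ℂ} {G' : E →L[ℝ] Matrix m m ℂ} {Z : E}
    (hG : HasFDerivAt G G' Z) (hZ : (G Z).det ≠ 0) :
    ∃ f' : E →L[ℝ] Matrix m m ℂ, HasFDerivAt (fun W => (G W)⁻¹) f' Z ∧
      ∀ v, f' v = -((G Z)⁻¹ * G' v * (G Z)⁻¹) := by
  refine ⟨_, ((hasFDerivAt_matrix_inv hZ).restrictScalars ℝ).comp Z hG, fun v => rfl⟩

theorem exists_hasFDerivAt_trace_mul {G H : E → Matrix m m ℂ} {G' H' : E →L[ℝ] Matrix m m ℂ}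
    {Z : E} (hG : HasFDerivAt G G' Z) (hH : HasFDerivAt H H' Z) :
    ∃ f' : E →L[ℝ] ℂ, HasFDerivAt (fun W => (G W * H W).trace) f' Z ∧
      ∀ v, f' v = (G' v * H Z + G Z * H' v).trace := by
  let T : Matrix m m ℂ →L[ℝ] ℂ :=
    LinearMap.toContinuousLinearMap ((Matrix.traceLinearMap m ℂ ℂ).restrictScalars ℝ)
  refine ⟨_, T.hasFDerivAt.comp Z (hG.mul' hH), fun v => ?_⟩
  change (G Z * H' v + G' v * H Z).trace = _
  rw [add_comm]

end MatrixCalculus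

/-! ### Möbius maps of symmetric matrices -/

namespace CartanIII

attribute [local instance] Matrix.linftyOpNormedRing Matrix.linftyOpNormedAlgebra

variable {n : ℕ}

theorem differentiable_mat : Differentiable ℂ (mat (n := n)) :=
  (LinearMap.toContinuousLinearMap (matL (n := n))).differentiable

/-- The Möbius-type map `Z ↦ a + b (Z + c)⁻¹` of symmetric matrices. -/
noncomputable def invMap (a b c : ℂ) (Z : Symm n) : Symm n :=
  ofMat (a • 1 + b • (mat Z + c • 1)⁻¹)

theorem isSymm_smul_one (c : ℂ) : (c • (1 : Matrix (Fin n) (Fin n) ℂ)).IsSymm :=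
  Matrix.isSymm_one.smul c

theorem isSymm_inv_mat_add (c : ℂ) (Z : Symm n) : ((mat Z + c • 1)⁻¹).IsSymm := by
  rw [Matrix.IsSymm, Matrix.transpose_nonsing_inv, ((mat_isSymm Z).add (isSymm_smul_one c)).eq]

theorem mat_invMap (a b c : ℂ) (Z : Symm n) :
    mat (invMap a b c Z) = a • 1 + b • (mat Z + c • 1)⁻¹ :=
  mat_ofMat ((isSymm_smul_one a).add ((isSymm_inv_mat_add c Z).smul b))

/-- The inverse of Z + c is symmetric, so the derivative -b (Z + c)⁻¹ U (Z + c)⁻¹ is a multiple of a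
`congrMap`, whose determinant is known. -/
theorem hasFDerivAt_invMap (a b : ℂ) {c : ℂ} {Z : Symm n} (hZ : (mat Z + c • 1).det ≠ 0) :
    HasFDerivAt (invMap a b c)
      (LinearMap.toContinuousLinearMap (-b • congrMap (mat Z + c • 1)⁻¹)) Z := by
  let M : Symm n →L[ℂ] Matrix (Fin n) (Fin n) ℂ := LinearMap.toContinuousLinearMap matL
  let N : Matrix (Fin n) (Fin n) ℂ →L[ℂ] Symm n := LinearMap.toContinuousLinearMap ofMat
  have h1 : HasFDerivAt (fun Z : Symm n => mat Z + c • 1) M Z := M.hasFDerivAt.add_const _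
  have h2 := N.hasFDerivAt.comp Z
    ((((hasFDerivAt_matrix_inv hZ).comp Z h1).const_smul b).const_add (a • 1))
  refine h2.congr_fderiv ?_
  ext1 U
  change ofMat (b • -((mat Z + c • 1)⁻¹ * mat U * (mat Z + c • 1)⁻¹))
    = -b • congrMap (mat Z + c • 1)⁻¹ U
  rw [congrMap_apply, (isSymm_inv_mat_add c Z).eq, ← map_smul, smul_neg, neg_smul]

theorem det_fderiv_invMap (b c : ℂ) (Z : Symm n) :
    ‖LinearMap.det (-b • congrMap (mat Z + c • 1)⁻¹)‖
      = ‖b ^ Fintype.card (Sym2 (Fin n)) * ((mat Z + c • 1).det⁻¹) ^ (n + 1)‖ := by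
  rw [LinearMap.det_smul, det_congrMap, Matrix.det_nonsing_inv, Ring.inverse_eq_inv']
  simp

theorem differentiableAt_det_inv {c : ℂ} {Z : Symm n} (hZ : (mat Z + c • 1).det ≠ 0) (N : ℂ) :
    DifferentiableAt ℂ (fun Z : Symm n => N * ((mat Z + c • 1).det⁻¹) ^ (n + 1)) Z := by
  have h : DifferentiableAt ℂ (fun Z : Symm n => (mat Z + c • 1).det) Z :=
    differentiable_det.differentiableAt.comp Z (differentiable_mat.differentiableAt.add_const _)
  exact ((h.inv hZ).pow _).const_mul _

end CartanIII

/-! ### Positive definite matrices -/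

section PosDef

open Matrix

variable {ι : Type*} [Fintype ι]

/-- The quadratic form is positive on the compact unit sphere, hence stays so for nearby parameters
by the tube lemma; homogeneity handles all other vectors. -/
theorem isOpen_setOf_posDef {X : Type*} [TopologicalSpace X] {𝕜 : Type*} [RCLike 𝕜]
    {M : X → Matrix ι ι 𝕜} (hM : Continuous M) (hH : ∀ x, (M x).IsHermitian) :
    IsOpen {x | (M x).PosDef} := by
  rw [isOpen_iff_mem_nhds]
  intro x hx
  let q : X × (ι → 𝕜) → ℝ := fun p => RCLike.re (star p.2 ⬝ᵥ (M p.1 *ᵥ p.2))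
  have hq : Continuous q := by
    refine RCLike.continuous_re.comp (Continuous.dotProduct ?_ ?_)
    · fun_prop
    · exact (hM.comp continuous_fst).matrix_mulVec continuous_snd
  have hsub : ({x} : Set X) ×ˢ Metric.sphere (0 : ι → 𝕜) 1 ⊆ {p | 0 < q p} := by
    rintro ⟨y, v⟩ ⟨rfl, hv⟩
    exact PosDef.re_dotProduct_pos hx (ne_zero_of_mem_unit_sphere ⟨v, hv⟩)
  obtain ⟨u, w, hu, -, hxu, hw, huw⟩ := generalized_tube_lemma isCompact_singleton
    (isCompact_sphere (0 : ι → 𝕜) 1) (isOpen_lt continuous_const hq) hsub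
  filter_upwards [hu.mem_nhds (hxu rfl)] with y hy
  refine PosDef.of_dotProduct_mulVec_pos (hH y) fun v hv => ?_
  have hv' : 0 < ‖v‖ := norm_pos_iff.2 hv
  let s : 𝕜 := ((‖v‖⁻¹ : ℝ) : 𝕜)
  have h1 : 0 < q (y, s • v) := huw ⟨hy, hw (by
    rw [mem_sphere_zero_iff_norm, norm_smul, RCLike.norm_ofReal, abs_of_pos (by positivity),
      inv_mul_cancel₀ hv'.ne'])⟩
  have h2 : q (y, s • v) = ‖v‖⁻¹ ^ 2 * RCLike.re (star v ⬝ᵥ (M y *ᵥ v)) := by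
    simp only [q, mulVec_smul, star_smul, smul_dotProduct, dotProduct_smul, smul_eq_mul, s,
      RCLike.star_def, RCLike.conj_ofReal, RCLike.re_ofReal_mul]
    ring
  rw [h2] at h1
  rw [RCLike.pos_iff]
  exact ⟨pos_of_mul_pos_right h1 (by positivity), (hH y).im_star_dotProduct_mulVec_self v⟩

variable [DecidableEq ι]

theorem Matrix.PosDef.exists_mul_transpose {Y : Matrix ι ι ℝ} (hY : Y.PosDef) :
    ∃ B : Matrix ι ι ℝ, B.det ≠ 0 ∧ B * Bᵀ = Y := by
  open scoped MatrixOrder in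
  obtain ⟨y, hy⟩ := CStarAlgebra.nonneg_iff_eq_star_mul_self.mp hY.posSemidef.nonneg
  have h : yᵀ * yᵀᵀ = Y := by
    rw [hy, transpose_transpose, star_eq_conjTranspose, conjTranspose_eq_transpose_of_trivial]
  refine ⟨yᵀ, fun h0 => hY.det_pos.ne' ?_, h⟩
  rw [← h, det_mul, h0, zero_mul]

theorem Matrix.PosDef.congr_of_det_ne_zero {𝕜 : Type*} [RCLike 𝕜] {M B : Matrix ι ι 𝕜}
    (hM : M.PosDef) (hB : B.det ≠ 0) : (B * M * Bᴴ).PosDef :=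
  hM.mul_mul_conjTranspose_same
    (vecMul_injective_iff_isUnit.2 ((isUnit_iff_isUnit_det B).2 hB.isUnit))

/-- A matrix with positive definite imaginary part is invertible. -/
theorem det_ne_zero_of_sub_conjTranspose {T Q : Matrix ι ι ℂ} (hQ : Q.PosDef)
    (h : T - Tᴴ = (2 * Complex.I) • Q) : T.det ≠ 0 := by
  intro h0
  obtain ⟨v, hv, hTv⟩ := exists_mulVec_eq_zero_iff.2 h0
  have h1 : star v ⬝ᵥ ((T - Tᴴ) *ᵥ v) = 0 := by
    rw [sub_mulVec, hTv, zero_sub, dotProduct_neg, dotProduct_mulVec, ← star_mulVec, hTv]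
    simp
  rw [h, smul_mulVec, dotProduct_smul, smul_eq_mul] at h1
  have h2 := hQ.dotProduct_mulVec_pos hv
  simp [h2.ne'] at h1

/-- `1 - Z` is invertible for a strict contraction `Z`. -/
theorem det_sub_one_ne_zero {Z : Matrix ι ι ℂ} (hZ : (1 - Z * Zᴴ).PosDef) : (Z - 1).det ≠ 0 := by
  intro h0
  obtain ⟨v, hv, hZv⟩ := exists_vecMul_eq_zero_iff.2 h0
  have h1 : v ᵥ* Z = v := by
    rw [vecMul_sub, vecMul_one, sub_eq_zero] at hZv
    exact hZv
  have h2 : Zᴴ *ᵥ star v = star v := by rw [← star_vecMul, h1]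
  have h3 := hZ.dotProduct_mulVec_pos (x := star v) (by simpa using hv)
  rw [star_star, sub_mulVec, one_mulVec, ← mulVec_mulVec, h2, dotProduct_sub,
    dotProduct_mulVec v Z, h1, sub_self] at h3
  exact h3.ne rfl

end PosDef

/-! ### The two domains and the Cayley transform -/

namespace CartanIII

open Matrix

variable {n : ℕ}

/-- For symmetric matrices conjugation is the conjugate transpose, so both domains become conditions
on Hermitian matrices. -/
theorem cbar_mat (Z : Symm n) : cbar (mat Z) = (mat Z)ᴴ := by
  ext j k
  simp [cbar, mat, conjTranspose_apply, Sym2.eq_swap]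

theorem mem_discDomain {Z : Symm n} : Z ∈ discDomain n ↔ (1 - mat Z * (mat Z)ᴴ).PosDef := by
  rw [← cbar_mat]
  rfl

theorem two_I_smul_toC_imM (Z : Symm n) :
    mat Z - (mat Z)ᴴ = (2 * Complex.I) • toC (imM (mat Z)) := by
  rw [← cbar_mat]
  ext j k
  simp only [cbar, toC, imM, Matrix.sub_apply, map_apply, Matrix.smul_apply, smul_eq_mul]
  rw [Complex.sub_conj]
  push_cast
  ring

theorem toC_imM_eq_of_sub {Z : Symm n} {Q : Matrix (Fin n) (Fin n) ℂ}
    (h : mat Z - (mat Z)ᴴ = (2 * Complex.I) • Q) : toC (imM (mat Z)) = Q := by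
  rw [two_I_smul_toC_imM] at h
  exact smul_right_injective _ (by simp : (2 * Complex.I) ≠ 0) h

theorem toC_mul (A B : Matrix (Fin n) (Fin n) ℝ) : toC (A * B) = toC A * toC B :=
  Matrix.map_mul (f := Complex.ofRealHom)

theorem toC_one : toC (1 : Matrix (Fin n) (Fin n) ℝ) = 1 :=
  Matrix.map_one _ Complex.ofReal_zero Complex.ofReal_one

theorem toC_transpose (A : Matrix (Fin n) (Fin n) ℝ) : (toC A)ᵀ = toC Aᵀ := rfl

theorem toC_conjTranspose (A : Matrix (Fin n) (Fin n) ℝ) : (toC A)ᴴ = toC Aᵀ := by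
  ext j k
  simp [toC, conjTranspose_apply]

theorem det_toC (A : Matrix (Fin n) (Fin n) ℝ) : (toC A).det = (A.det : ℂ) :=
  (Complex.ofRealHom.map_det A).symm

theorem toC_inv (A : Matrix (Fin n) (Fin n) ℝ) (hA : A.det ≠ 0) : toC A⁻¹ = (toC A)⁻¹ := by
  refine (inv_eq_right_inv ?_).symm
  rw [← toC_mul, mul_nonsing_inv _ hA.isUnit, toC_one]

theorem posDef_toC_iff {Y : Matrix (Fin n) (Fin n) ℝ} : (toC Y).PosDef ↔ Y.PosDef := by
  constructor
  · intro h
    refine PosDef.of_dotProduct_mulVec_pos ?_ fun v hv => ?_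
    · have h1 := h.isHermitian
      rw [IsHermitian, toC_conjTranspose] at h1
      rw [IsHermitian, conjTranspose_eq_transpose_of_trivial]
      exact map_injective Complex.ofReal_injective h1
    · have h1 := h.dotProduct_mulVec_pos (x := fun i => (v i : ℂ)) (by
        intro h0
        exact hv (funext fun i => by simpa using congrFun h0 i))
      have h2 : star (fun i => (v i : ℂ)) ⬝ᵥ (toC Y *ᵥ fun i => (v i : ℂ))
          = ((star v ⬝ᵥ (Y *ᵥ v) : ℝ) : ℂ) := by
        simp [dotProduct, mulVec, toC]
      rw [h2] at h1
      exact_mod_cast h1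
  · intro h
    -- Writing Y = B Bᵀ makes the complexification congruent to the identity.
    obtain ⟨B, hB, rfl⟩ := h.exists_mul_transpose
    rw [toC_mul, ← toC_conjTranspose]
    have := PosDef.one.congr_of_det_ne_zero (𝕜 := ℂ) (B := toC B) (by
      rw [det_toC]; exact_mod_cast hB)
    rwa [mul_one] at this

theorem mem_siegelDomain {Z : Symm n} : Z ∈ siegelDomain n ↔ (toC (imM (mat Z))).PosDef :=
  posDef_toC_iff.symm

theorem continuous_mat : Continuous (mat (n := n)) := by
  refine continuous_matrix fun j k => ?_
  exact continuous_apply _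

theorem isOpen_discDomain : IsOpen (discDomain n) := by
  have h : discDomain n = {Z | (1 - mat Z * (mat Z)ᴴ).PosDef} := Set.ext fun Z => mem_discDomain
  rw [h]
  refine isOpen_setOf_posDef ?_ fun Z => ?_
  · exact continuous_const.sub (continuous_mat.matrix_mul continuous_mat.matrix_conjTranspose)
  · exact isHermitian_one.sub (isHermitian_mul_conjTranspose_self _)

theorem isOpen_siegelDomain : IsOpen (siegelDomain n) := by
  refine isOpen_setOf_posDef ?_ fun Z => ?_
  · exact continuous_mat.matrix_map Complex.continuous_im
  · rw [IsHermitian, conjTranspose_eq_transpose_of_trivial]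
    exact congrArg imM (mat_isSymm Z)

theorem zero_mem_discDomain : (0 : Symm n) ∈ discDomain n := by
  have h : mat (0 : Symm n) = 0 := rfl
  rw [mem_discDomain, h]
  simpa using PosDef.one

/-- The diagonal entries of 1 - Z Z* are positive, which bounds every row of Z in ℓ². -/
theorem discDomain_subset : discDomain n ⊆ Metric.closedBall 0 1 := by
  intro Z hZ
  rw [mem_closedBall_zero_iff, pi_norm_le_iff_of_nonneg zero_le_one]
  intro p
  induction p with
  | _ j k =>
    have h := (mem_discDomain.1 hZ).diag_pos (i := j)
    have h1 : (mat Z * (mat Z)ᴴ) j j = ((∑ k, ‖Z s(j, k)‖ ^ 2 : ℝ) : ℂ) := by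
      simp [mul_apply, conjTranspose_apply, mat, Complex.mul_conj']
    rw [Matrix.sub_apply, one_apply_eq, h1, ← Complex.ofReal_one, ← Complex.ofReal_sub,
      Complex.zero_lt_real] at h
    have h2 : ‖Z s(j, k)‖ ^ 2 ≤ ∑ k, ‖Z s(j, k)‖ ^ 2 :=
      Finset.single_le_sum (f := fun k => ‖Z s(j, k)‖ ^ 2) (fun k _ => by positivity)
        (Finset.mem_univ k)
    nlinarith [norm_nonneg (Z s(j, k))]

instance isAddHaarMeasure_normMeasure : (normMeasure n).IsAddHaarMeasure := by
  refine Measure.IsAddHaarMeasure.smul _ ?_ ?_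
  · rw [ENNReal.inv_ne_zero]
    exact ((measure_mono discDomain_subset).trans_lt
      (isCompact_closedBall _ _).measure_lt_top).ne
  · rw [ENNReal.inv_ne_top]
    exact (isOpen_discDomain.measure_pos _ ⟨0, zero_mem_discDomain⟩).ne'

/-- The Cayley transform from the disc to the Siegel domain. -/
noncomputable def cayley : Symm n → Symm n := invMap (-Complex.I) (-2 * Complex.I) (-1)

/-- The inverse Cayley transform. -/
noncomputable def cayleyInv : Symm n → Symm n := invMap 1 (-2 * Complex.I) Complex.I

theorem det_mat_add_ne_zero_of_mem_disc {Z : Symm n} (hZ : Z ∈ discDomain n) :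
    (mat Z + (-1 : ℂ) • 1).det ≠ 0 := by
  rw [neg_one_smul, ← sub_eq_add_neg]
  exact det_sub_one_ne_zero (mem_discDomain.1 hZ)

theorem mat_add_sub_conjTranspose (W : Symm n) :
    (mat W + Complex.I • 1) - (mat W + Complex.I • 1)ᴴ
      = (2 * Complex.I) • (toC (imM (mat W)) + 1) := by
  rw [conjTranspose_add, conjTranspose_smul, conjTranspose_one, smul_add, ← two_I_smul_toC_imM,
    Complex.star_def, Complex.conj_I]
  module

theorem det_mat_add_ne_zero_of_mem_siegel {W : Symm n} (hW : W ∈ siegelDomain n) :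
    (mat W + Complex.I • 1).det ≠ 0 :=
  det_ne_zero_of_sub_conjTranspose ((mem_siegelDomain.1 hW).add .one) (mat_add_sub_conjTranspose W)

/-- The inverse of a + b/(z + c) is -c + b/(w - a). The Cayley pair i(1 + Z)(1 - Z)⁻¹ and (W - i)(W
+ i)⁻¹ has this shape with b = -2i in both directions. -/
theorem invMap_invMap (a : ℂ) {b c : ℂ} (hb : b ≠ 0) {Z : Symm n}
    (hZ : (mat Z + c • 1).det ≠ 0) : invMap (-c) b (-a) (invMap a b c Z) = Z := by
  apply mat_injective
  have h : (b • (mat Z + c • 1)⁻¹)⁻¹ = b⁻¹ • (mat Z + c • 1) := by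
    refine inv_eq_right_inv ?_
    rw [smul_mul_smul_comm, mul_inv_cancel₀ hb, nonsing_inv_mul _ hZ.isUnit, one_smul]
  rw [mat_invMap, mat_invMap]
  have h2 : a • 1 + b • (mat Z + c • 1)⁻¹ + -a • 1 = b • (mat Z + c • 1)⁻¹ := by module
  rw [h2, h, smul_smul, mul_inv_cancel₀ hb]
  module

theorem cayleyInv_cayley {Z : Symm n} (hZ : Z ∈ discDomain n) : cayleyInv (cayley Z) = Z := by
  have h := invMap_invMap (-Complex.I) (b := -2 * Complex.I) (by simp)
    (det_mat_add_ne_zero_of_mem_disc hZ)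
  rwa [neg_neg, neg_neg] at h

theorem cayley_cayleyInv {W : Symm n} (hW : W ∈ siegelDomain n) : cayley (cayleyInv W) = W :=
  invMap_invMap 1 (b := -2 * Complex.I) (by simp) (det_mat_add_ne_zero_of_mem_siegel hW)

/-- The congruence with 1 - Z Z* serves twice: it maps the disc into the Siegel domain and relates
the determinants in the two kernel formulas. -/
theorem toC_imM_cayley {Z : Symm n} (hZ : Z ∈ discDomain n) :
    toC (imM (mat (cayley Z))) = (mat Z + (-1 : ℂ) • 1)⁻¹ * (1 - mat Z * (mat Z)ᴴ)
      * ((mat Z + (-1 : ℂ) • 1)⁻¹)ᴴ := by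
  apply toC_imM_eq_of_sub
  have hS : IsUnit (mat Z + (-1 : ℂ) • 1).det := (det_mat_add_ne_zero_of_mem_disc hZ).isUnit
  rw [cayley, mat_invMap]
  obtain ⟨S, hSdef⟩ : ∃ S, S = mat Z + (-1 : ℂ) • 1 := ⟨_, rfl⟩
  have hZS : mat Z = S + 1 := by rw [hSdef]; module
  rw [← hSdef] at hS ⊢
  have e1 : S⁻¹ * S = 1 := nonsing_inv_mul _ hS
  have e2 : Sᴴ * S⁻¹ᴴ = 1 := by rw [← conjTranspose_mul, e1, conjTranspose_one]
  have key : S⁻¹ * (1 - mat Z * (mat Z)ᴴ) * S⁻¹ᴴ = -(S⁻¹ + S⁻¹ᴴ + 1) := by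
    have h1 : 1 - mat Z * (mat Z)ᴴ = -(S + Sᴴ + S * Sᴴ) := by
      rw [hZS, conjTranspose_add, conjTranspose_one]
      noncomm_ring
    rw [h1]
    calc S⁻¹ * -(S + Sᴴ + S * Sᴴ) * S⁻¹ᴴ
        = -((S⁻¹ * S) * S⁻¹ᴴ + S⁻¹ * (Sᴴ * S⁻¹ᴴ) + (S⁻¹ * S) * (Sᴴ * S⁻¹ᴴ)) := by noncomm_ring
      _ = _ := by rw [e1, e2]; noncomm_ring
  rw [key]
  simp only [conjTranspose_add, conjTranspose_smul, conjTranspose_one, star_neg, star_mul',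
    Complex.star_def, Complex.conj_I, map_ofNat]
  module

theorem one_sub_cayleyInv {W : Symm n} (hW : W ∈ siegelDomain n) :
    1 - mat (cayleyInv W) * (mat (cayleyInv W))ᴴ
      = ((2 : ℂ) • (mat W + Complex.I • 1)⁻¹) * toC (imM (mat W))
        * ((2 : ℂ) • (mat W + Complex.I • 1)⁻¹)ᴴ := by
  have hT : IsUnit (mat W + Complex.I • 1).det := (det_mat_add_ne_zero_of_mem_siegel hW).isUnit
  have hsub := mat_add_sub_conjTranspose W
  rw [cayleyInv, mat_invMap]
  obtain ⟨T, hTdef⟩ : ∃ T, T = mat W + Complex.I • 1 := ⟨_, rfl⟩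
  rw [← hTdef] at hT hsub ⊢
  have e1 : T⁻¹ * T = 1 := nonsing_inv_mul _ hT
  have e2 : Tᴴ * T⁻¹ᴴ = 1 := by rw [← conjTranspose_mul, e1, conjTranspose_one]
  have hY : toC (imM (mat W)) = (2 * Complex.I)⁻¹ • (T - Tᴴ) - 1 := by
    rw [hsub, smul_smul, inv_mul_cancel₀ (by simp), one_smul, add_sub_cancel_right]
  have key : T⁻¹ * (T - Tᴴ) * T⁻¹ᴴ = T⁻¹ᴴ - T⁻¹ := by
    rw [mul_sub, sub_mul, e1, one_mul, mul_assoc, e2, mul_one]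
  generalize hP : T⁻¹ = P at key ⊢
  generalize T - Tᴴ = Δ at key hY
  have r1 : ((2 : ℂ) • P) * ((2 * Complex.I)⁻¹ • Δ - 1) * ((2 : ℂ) • P)ᴴ
      = (4 * (2 * Complex.I)⁻¹) • (P * Δ * Pᴴ) - (4 : ℂ) • (P * Pᴴ) := by
    simp only [conjTranspose_smul, Complex.star_def, map_ofNat, mul_sub, sub_mul,
      smul_mul_assoc, mul_smul_comm, mul_one, smul_sub, smul_smul]
    match_scalars <;> ring
  have r2 : (1 : Matrix (Fin n) (Fin n) ℂ) - ((1 : ℂ) • 1 + (-2 * Complex.I) • P)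
      * ((1 : ℂ) • 1 + (-2 * Complex.I) • P)ᴴ
      = (2 * Complex.I) • P - (2 * Complex.I) • Pᴴ + (4 * Complex.I ^ 2) • (P * Pᴴ) := by
    simp only [conjTranspose_add, conjTranspose_smul, conjTranspose_one, star_neg, star_mul',
      Complex.star_def, Complex.conj_I, map_ofNat, one_smul, mul_add, add_mul, one_mul,
      smul_mul_assoc, mul_smul_comm, mul_one]
    match_scalars <;> ring
  have r3 : 4 * (2 * Complex.I)⁻¹ = -(2 * Complex.I) := by
    rw [mul_inv, Complex.inv_I]
    ring
  rw [hY, r1, r2, key, r3, Complex.I_sq]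
  module

theorem cayley_mem {Z : Symm n} (hZ : Z ∈ discDomain n) : cayley Z ∈ siegelDomain n := by
  rw [mem_siegelDomain, toC_imM_cayley hZ]
  refine (mem_discDomain.1 hZ).congr_of_det_ne_zero ?_
  rw [det_nonsing_inv, Ring.inverse_eq_inv']
  exact inv_ne_zero (det_mat_add_ne_zero_of_mem_disc hZ)

theorem cayleyInv_mem {W : Symm n} (hW : W ∈ siegelDomain n) : cayleyInv W ∈ discDomain n := by
  rw [mem_discDomain, one_sub_cayleyInv hW]
  refine (mem_siegelDomain.1 hW).congr_of_det_ne_zero ?_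
  rw [det_smul, det_nonsing_inv, Ring.inverse_eq_inv']
  exact mul_ne_zero (by simp) (inv_ne_zero (det_mat_add_ne_zero_of_mem_siegel hW))

end CartanIII

/-! ### The kernels on the diagonal -/

namespace CartanIII

open Matrix

variable {n : ℕ}

/-- The affine map `Z ↦ A Z Aᵀ + X`. -/
noncomputable def affineMap (A : Matrix (Fin n) (Fin n) ℝ) (X Z : Symm n) : Symm n :=
  congrMap (toC A) Z + X

theorem mat_affineMap (A : Matrix (Fin n) (Fin n) ℝ) (X Z : Symm n) :
    mat (affineMap A X Z) = toC A * mat Z * (toC A)ᵀ + mat X := by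
  rw [← mat_congrMap]
  rfl

theorem toC_imM_affineMap {A : Matrix (Fin n) (Fin n) ℝ} {X : Symm n}
    (hX : (mat X)ᴴ = mat X) (Z : Symm n) :
    toC (imM (mat (affineMap A X Z))) = toC A * toC (imM (mat Z)) * (toC A)ᴴ := by
  apply toC_imM_eq_of_sub
  have hA : (toC A)ᵀ = (toC A)ᴴ := by rw [toC_transpose, toC_conjTranspose]
  rw [mat_affineMap, hA, conjTranspose_add, conjTranspose_mul, conjTranspose_mul,
    conjTranspose_conjTranspose, hX, add_sub_add_right_eq_sub, ← mul_assoc, ← sub_mul, ← mul_sub,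
    two_I_smul_toC_imM, mul_smul_comm, smul_mul_assoc]

theorem affineMap_mem {A : Matrix (Fin n) (Fin n) ℝ} (hA : A.det ≠ 0) {X : Symm n}
    (hX : (mat X)ᴴ = mat X) {Z : Symm n} (hZ : Z ∈ siegelDomain n) :
    affineMap A X Z ∈ siegelDomain n := by
  rw [mem_siegelDomain, toC_imM_affineMap hX]
  refine (mem_siegelDomain.1 hZ).congr_of_det_ne_zero ?_
  rw [det_toC]
  exact_mod_cast hA

theorem affineMap_affineMap {A : Matrix (Fin n) (Fin n) ℝ} (hA : A.det ≠ 0) (X Z : Symm n) :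
    affineMap A⁻¹ (-congrMap (toC A⁻¹) X) (affineMap A X Z) = Z := by
  have h : congrMap (toC A⁻¹) (congrMap (toC A) Z) = Z := by
    rw [← LinearMap.comp_apply, ← congrMap_mul, ← toC_mul, nonsing_inv_mul _ hA.isUnit, toC_one,
      congrMap_one, LinearMap.id_apply]
  rw [affineMap, affineMap, map_add, h, add_neg_cancel_right]

section

variable {μ : Measure (Symm n)} [μ.IsAddHaarMeasure] {K K' : Symm n → Symm n → ℂ}

theorem IsBergmanKernel.affine_le (hK : IsBergmanKernel (siegelDomain n) μ K)
    {A : Matrix (Fin n) (Fin n) ℝ} (hA : A.det ≠ 0) {X : Symm n} (hX : (mat X)ᴴ = mat X)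
    {Z : Symm n} (hZ : Z ∈ siegelDomain n) :
    (A.det ^ 2) ^ (n + 1) * ‖K (affineMap A X Z) (affineMap A X Z)‖ ≤ ‖K Z Z‖ := by
  have h := hK.norm_sq_mul_le hK isOpen_siegelDomain isOpen_siegelDomain (Φ := affineMap A X)
    (Φ' := fun _ => LinearMap.toContinuousLinearMap (congrMap (toC A)))
    (j := fun _ => (A.det : ℂ) ^ (n + 1))
    (fun Z _ => (LinearMap.toContinuousLinearMap (congrMap (toC A))).hasFDerivAt.add_const X)
    (Function.LeftInverse.injective (affineMap_affineMap hA X)).injOn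
    (fun Z hZ => affineMap_mem hA hX hZ) (differentiableOn_const _)
    (fun Z _ => by
      change ‖LinearMap.det (congrMap (toC A))‖ = _
      rw [det_congrMap, det_toC]) hZ
  rwa [norm_pow, ← pow_mul, mul_comm (n + 1), pow_mul, Complex.norm_real, Real.norm_eq_abs,
    sq_abs] at h

/-- The base point `i I` of the Siegel domain. -/
noncomputable def siegelBase (n : ℕ) : Symm n := ofMat (Complex.I • 1)

theorem mat_siegelBase : mat (siegelBase n) = Complex.I • 1 := mat_ofMat (isSymm_smul_one _)

theorem toC_imM_siegelBase : toC (imM (mat (siegelBase n))) = 1 := by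
  apply toC_imM_eq_of_sub
  rw [mat_siegelBase, conjTranspose_smul, conjTranspose_one, Complex.star_def, Complex.conj_I]
  module

theorem siegelBase_mem : siegelBase n ∈ siegelDomain n := by
  rw [mem_siegelDomain, toC_imM_siegelBase]
  exact .one

/-- Transitivity on the Siegel domain: A is a square root of Im Z in the sense A Aᵀ = Im Z, and X is
Re Z. -/
theorem exists_affineMap_siegelBase {Z : Symm n} (hZ : Z ∈ siegelDomain n) :
    ∃ (A : Matrix (Fin n) (Fin n) ℝ) (X : Symm n), A.det ≠ 0 ∧ A * Aᵀ = imM (mat Z) ∧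
      (mat X)ᴴ = mat X ∧ affineMap A X (siegelBase n) = Z := by
  obtain ⟨A, hA, hAA⟩ := Matrix.PosDef.exists_mul_transpose hZ
  refine ⟨A, Z - congrMap (toC A) (siegelBase n), hA, hAA, ?_, add_sub_cancel _ _⟩
  have h1 : mat (Z - congrMap (toC A) (siegelBase n))
      = mat Z - Complex.I • toC (imM (mat Z)) := by
    have : mat (Z - congrMap (toC A) (siegelBase n))
      = mat Z - mat (congrMap (toC A) (siegelBase n)) := rfl
    rw [this, mat_congrMap, mat_siegelBase, ← hAA, toC_mul, toC_transpose, mul_smul_comm,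
      mul_one, smul_mul_assoc]
  have h2 : Complex.I • toC (imM (mat Z)) = (2 : ℂ)⁻¹ • (mat Z - (mat Z)ᴴ) := by
    rw [two_I_smul_toC_imM, smul_smul, inv_mul_cancel_left₀ two_ne_zero]
  rw [h1, h2]
  simp only [conjTranspose_sub, conjTranspose_smul, conjTranspose_conjTranspose,
    Complex.star_def, map_inv₀, map_ofNat]
  match_scalars <;> norm_num

/-- Monotonicity for the affine map from the base point to Z and for its inverse gives the two
inequalities. -/
theorem IsBergmanKernel.siegel_norm_eq (hK : IsBergmanKernel (siegelDomain n) μ K)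
    {Z : Symm n} (hZ : Z ∈ siegelDomain n) :
    ‖K Z Z‖ = ‖K (siegelBase n) (siegelBase n)‖ * ((imM (mat Z)).det ^ (n + 1))⁻¹ := by
  obtain ⟨A, X, hA, hAA, hX, rfl⟩ := exists_affineMap_siegelBase hZ
  have h1 := hK.affine_le hA hX siegelBase_mem
  have hX' : (mat (-congrMap (toC A⁻¹) X))ᴴ = mat (-congrMap (toC A⁻¹) X) := by
    have : mat (-congrMap (toC A⁻¹) X) = -mat (congrMap (toC A⁻¹) X) := rfl
    rw [this, mat_congrMap, conjTranspose_neg, conjTranspose_mul, conjTranspose_mul, hX,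
      toC_transpose, ← toC_conjTranspose, conjTranspose_conjTranspose, mul_assoc]
  have hA' : A⁻¹.det ≠ 0 := by
    rw [det_nonsing_inv, Ring.inverse_eq_inv']
    exact inv_ne_zero hA
  have h2 := hK.affine_le hA' hX' hZ
  rw [affineMap_affineMap hA, det_nonsing_inv, Ring.inverse_eq_inv', inv_pow, inv_pow,
    inv_mul_le_iff₀ (by positivity)] at h2
  rw [← hAA, det_mul, det_transpose, ← sq, ← div_eq_mul_inv, eq_div_iff (by positivity), mul_comm]
  exact le_antisymm h1 h2

/-- The Jacobian determinant of the map `invMap a b c`. -/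
noncomputable def invMapJac (n : ℕ) (b c : ℂ) (Z : Symm n) : ℂ :=
  b ^ Fintype.card (Sym2 (Fin n)) * ((mat Z + c • 1).det⁻¹) ^ (n + 1)

theorem IsBergmanKernel.cayley_le (hK : IsBergmanKernel (discDomain n) μ K)
    (hK' : IsBergmanKernel (siegelDomain n) μ K') {Z : Symm n} (hZ : Z ∈ discDomain n) :
    ‖invMapJac n (-2 * Complex.I) (-1) Z‖ ^ 2 * ‖K' (cayley Z) (cayley Z)‖ ≤ ‖K Z Z‖ :=
  hK.norm_sq_mul_le hK' isOpen_discDomain isOpen_siegelDomain (Φ := cayley)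
    (fun _ hZ => hasFDerivAt_invMap _ _ (det_mat_add_ne_zero_of_mem_disc hZ))
    (fun Z hZ W hW h => by rw [← cayleyInv_cayley hZ, h, cayleyInv_cayley hW])
    (fun _ hZ => cayley_mem hZ)
    (fun _ hZ => (differentiableAt_det_inv
      (det_mat_add_ne_zero_of_mem_disc hZ) _).differentiableWithinAt)
    (fun Z _ => det_fderiv_invMap _ _ Z) hZ

theorem IsBergmanKernel.cayleyInv_le (hK : IsBergmanKernel (discDomain n) μ K)
    (hK' : IsBergmanKernel (siegelDomain n) μ K') {W : Symm n} (hW : W ∈ siegelDomain n) :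
    ‖invMapJac n (-2 * Complex.I) Complex.I W‖ ^ 2 * ‖K (cayleyInv W) (cayleyInv W)‖
      ≤ ‖K' W W‖ :=
  hK'.norm_sq_mul_le hK isOpen_siegelDomain isOpen_discDomain (Φ := cayleyInv)
    (fun _ hZ => hasFDerivAt_invMap _ _ (det_mat_add_ne_zero_of_mem_siegel hZ))
    (fun Z hZ W hW h => by rw [← cayley_cayleyInv hZ, h, cayley_cayleyInv hW])
    (fun _ hZ => cayleyInv_mem hZ)
    (fun _ hZ => (differentiableAt_det_inv
      (det_mat_add_ne_zero_of_mem_siegel hZ) _).differentiableWithinAt)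
    (fun Z _ => det_fderiv_invMap _ _ Z) hW

theorem invMapJac_ne_zero {b c : ℂ} (hb : b ≠ 0) {Z : Symm n} (hZ : (mat Z + c • 1).det ≠ 0) :
    invMapJac n b c Z ≠ 0 :=
  mul_ne_zero (pow_ne_zero _ hb) (pow_ne_zero _ (inv_ne_zero hZ))

/-- With b = -2i and d = det(Z - 1), the determinant of cayley(Z) + i is bⁿ/d. The powers of b
cancel because the dimension of the space is n(n + 1)/2. -/
theorem invMapJac_cayley_mul {Z : Symm n} (hZ : Z ∈ discDomain n) :
    invMapJac n (-2 * Complex.I) Complex.I (cayley Z) * invMapJac n (-2 * Complex.I) (-1) Z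
      = 1 := by
  have hd := det_mat_add_ne_zero_of_mem_disc hZ
  have h1 : mat (cayley Z) + Complex.I • 1
      = (-2 * Complex.I) • (mat Z + (-1 : ℂ) • 1)⁻¹ := by
    rw [cayley, mat_invMap]
    module
  have hb : (-2 * Complex.I) ≠ 0 := by simp
  have hcard : Fintype.card (Sym2 (Fin n)) * 2 = n * (n + 1) := by
    rw [Sym2.card, Fintype.card_fin, Nat.choose_two_right, Nat.add_sub_cancel,
      Nat.div_mul_cancel (by rw [mul_comm]; exact (Nat.even_mul_succ_self n).two_dvd), mul_comm]
  rw [invMapJac, invMapJac, h1, det_smul, Fintype.card_fin, det_nonsing_inv,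
    Ring.inverse_eq_inv']
  generalize (mat Z + (-1 : ℂ) • 1).det = d at hd
  generalize -2 * Complex.I = b at hb
  rw [mul_inv, inv_inv, mul_pow, inv_pow, ← pow_mul, ← hcard, inv_pow, pow_mul]
  field_simp

/-- The two Cayley inequalities have reciprocal Jacobians and so are equalities; the powers of det(Z
- 1) in the Jacobian cancel those in det Im(cayley Z). -/
theorem IsBergmanKernel.disc_norm_eq (hK : IsBergmanKernel (discDomain n) μ K)
    (hK' : IsBergmanKernel (siegelDomain n) μ K') {Z : Symm n} (hZ : Z ∈ discDomain n) :
    ‖K Z Z‖ = ‖(-2 * Complex.I) ^ Fintype.card (Sym2 (Fin n))‖ ^ 2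
      * ‖K' (siegelBase n) (siegelBase n)‖ * (‖(1 - mat Z * cbar (mat Z)).det‖ ^ (n + 1))⁻¹ := by
  have h1 := hK.cayley_le hK' hZ
  have h2 := hK.cayleyInv_le hK' (cayley_mem hZ)
  rw [cayleyInv_cayley hZ] at h2
  have hmul : ‖invMapJac n (-2 * Complex.I) Complex.I (cayley Z)‖
      * ‖invMapJac n (-2 * Complex.I) (-1) Z‖ = 1 := by
    rw [← norm_mul, invMapJac_cayley_mul hZ, norm_one]
  have h3 : ‖K Z Z‖
      = ‖invMapJac n (-2 * Complex.I) (-1) Z‖ ^ 2 * ‖K' (cayley Z) (cayley Z)‖ := by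
    refine le_antisymm ?_ h1
    calc ‖K Z Z‖ = ‖invMapJac n (-2 * Complex.I) (-1) Z‖ ^ 2
          * (‖invMapJac n (-2 * Complex.I) Complex.I (cayley Z)‖ ^ 2 * ‖K Z Z‖) := by
          rw [← mul_assoc, ← mul_pow, mul_comm ‖invMapJac n _ (-1) Z‖, hmul, one_pow, one_mul]
      _ ≤ _ := by gcongr
  have hd := norm_ne_zero_iff.2 (det_mat_add_ne_zero_of_mem_disc hZ)
  have hδ : (1 - mat Z * (mat Z)ᴴ).det ≠ 0 := (mem_discDomain.1 hZ).det_pos.ne'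
  have hδ' := norm_ne_zero_iff.2 hδ
  have h4 : (imM (mat (cayley Z))).det
      = ‖(mat Z + (-1 : ℂ) • 1).det‖⁻¹ ^ 2 * ‖(1 - mat Z * (mat Z)ᴴ).det‖ := by
    have hpos : 0 < (imM (mat (cayley Z))).det := PosDef.det_pos (cayley_mem hZ)
    have h5 := congrArg (fun M => ‖M.det‖) (toC_imM_cayley hZ)
    simp only [det_toC, det_mul, det_conjTranspose, det_nonsing_inv, Ring.inverse_eq_inv',
      norm_mul, norm_star, norm_inv, Complex.norm_real, Real.norm_of_nonneg hpos.le] at h5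
    rw [h5]
    ring
  rw [h3, hK'.siegel_norm_eq (cayley_mem hZ), h4, cbar_mat, invMapJac, norm_mul]
  simp only [norm_pow, norm_inv]
  have h6 : ∀ x y : ℝ, (x ^ 2 * y) ^ (n + 1) = (x ^ (n + 1)) ^ 2 * y ^ (n + 1) := fun x y => by ring
  have h7 := pow_ne_zero (n + 1) (inv_ne_zero hd)
  rw [h6]
  generalize ‖(mat Z + (-1 : ℂ) • 1).det‖⁻¹ ^ (n + 1) = y at h7
  field_simp

/-- The disc is bounded, so 1 lies in its Bergman space; a zero on the diagonal would force it to
vanish there. -/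
theorem IsBergmanKernel.disc_ne_zero (hK : IsBergmanKernel (discDomain n) μ K) {Z : Symm n}
    (hZ : Z ∈ discDomain n) : K Z Z ≠ 0 := by
  intro h0
  have hfin : IsFiniteMeasure (μ.restrict (discDomain n)) :=
    ⟨by
      rw [Measure.restrict_apply_univ]
      exact (measure_mono discDomain_subset).trans_lt (isCompact_closedBall _ _).measure_lt_top⟩
  have h1 : MemBergman (discDomain n) μ fun _ => 1 :=
    ⟨differentiableOn_const _, memLp_const _⟩
  have h2 := hK.norm_sq_le isOpen_discDomain h1 hZ
  rw [h0] at h2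
  norm_num at h2

theorem IsBergmanKernel.siegel_ne_zero (hK' : IsBergmanKernel (siegelDomain n) μ K')
    {W : Symm n} (hW : W ∈ siegelDomain n) : K' W W ≠ 0 := by
  obtain ⟨K, hK⟩ := exists_isBergmanKernel (isOpen_discDomain (n := n)) μ
  have h1 := hK.cayleyInv_le hK' hW
  have h2 : 0 < ‖K (cayleyInv W) (cayleyInv W)‖ :=
    norm_pos_iff.2 (hK.disc_ne_zero (cayleyInv_mem hW))
  have h3 : 0 < ‖invMapJac n (-2 * Complex.I) Complex.I W‖ :=
    norm_pos_iff.2 (invMapJac_ne_zero (by simp) (det_mat_add_ne_zero_of_mem_siegel hW))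
  exact norm_pos_iff.1 (lt_of_lt_of_le (by positivity) h1)

theorem IsBergmanKernel.diag_pos {D : Set (Symm n)} (hK : IsBergmanKernel D μ K)
    (hD : IsOpen D) {Z : Symm n} (hZ : Z ∈ D) (h : K Z Z ≠ 0) : 0 < K Z Z := by
  rw [hK.diag_eq_norm hD hZ]
  exact_mod_cast norm_pos_iff.2 h

theorem log_diag_eq {D : Set (Symm n)} (hK : IsBergmanKernel D μ K) (hD : IsOpen D)
    {Z : Symm n} (hZ : Z ∈ D) {C : ℝ} {δ : ℂ} (hC : 0 < C) (hδ : 0 < δ)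
    (h : ‖K Z Z‖ = C * (‖δ‖ ^ (n + 1))⁻¹) :
    Complex.log (K Z Z) = Real.log C - (n + 1) * Complex.log δ := by
  have hδ' : δ = (‖δ‖ : ℂ) := (Complex.norm_of_nonneg' hδ.le).symm
  have hpos : 0 < ‖δ‖ := norm_pos_iff.2 hδ.ne'
  rw [hK.diag_eq_norm hD hZ, h, ← Complex.ofReal_log (by positivity),
    Real.log_mul hC.ne' (by positivity), Real.log_inv, Real.log_pow, hδ',
    ← Complex.ofReal_log (norm_nonneg _), Complex.norm_real, norm_norm]
  push_cast
  ring

theorem IsBergmanKernel.exists_log_siegel (hK : IsBergmanKernel (siegelDomain n) μ K) :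
    ∃ c : ℂ, ∀ Z ∈ siegelDomain n, Complex.log (K Z Z)
      = c - (n + 1) * Complex.log (toC (imM (mat Z))).det := by
  refine ⟨_, fun Z hZ => log_diag_eq hK isOpen_siegelDomain hZ
    (norm_pos_iff.2 (hK.siegel_ne_zero siegelBase_mem)) (mem_siegelDomain.1 hZ).det_pos ?_⟩
  have hpos : 0 < (imM (mat Z)).det := PosDef.det_pos hZ
  rw [hK.siegel_norm_eq hZ, det_toC, Complex.norm_real, Real.norm_of_nonneg hpos.le]

theorem IsBergmanKernel.exists_log_disc (hK : IsBergmanKernel (discDomain n) μ K) :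
    ∃ c : ℂ, ∀ Z ∈ discDomain n, Complex.log (K Z Z)
      = c - (n + 1) * Complex.log (1 - mat Z * cbar (mat Z)).det := by
  obtain ⟨K', hK'⟩ := exists_isBergmanKernel (isOpen_siegelDomain (n := n)) μ
  have hC : 0 < ‖K' (siegelBase n) (siegelBase n)‖ :=
    norm_pos_iff.2 (hK'.siegel_ne_zero siegelBase_mem)
  have hb : 0 < ‖(-2 * Complex.I) ^ Fintype.card (Sym2 (Fin n))‖ := norm_pos_iff.2 (by simp)
  exact ⟨_, fun Z hZ => log_diag_eq hK isOpen_discDomain hZ (by positivity)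
    (Matrix.PosDef.det_pos hZ) (hK.disc_norm_eq hK' hZ)⟩

end

end CartanIII

/-! ### Second Wirtinger derivatives, metrics and Kähler forms -/

namespace CartanIII

attribute [local instance] Matrix.linftyOpNormedRing Matrix.linftyOpNormedAlgebra

open Matrix

variable {n : ℕ}

/-- Here p and q are the coefficients of the differential p dz + q dz̄ along the coordinate a, read
off at 1 and i. -/
theorem dz_eq {f : Symm n → ℂ} {f' : Symm n →L[ℝ] ℂ} {Z : Symm n} (hf : HasFDerivAt f f' Z)
    {a : Sym2 (Fin n)} {p q : ℂ} (h1 : f' (Pi.single a 1) = p + q)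
    (h2 : f' (Pi.single a Complex.I) = Complex.I * (p - q)) : dz a f Z = p := by
  rw [dz, hf.fderiv, h1, h2, ← mul_assoc, Complex.I_mul_I]
  ring

theorem dzbar_eq {f : Symm n → ℂ} {f' : Symm n →L[ℝ] ℂ} {Z : Symm n} (hf : HasFDerivAt f f' Z)
    {a : Sym2 (Fin n)} {p q : ℂ} (h1 : f' (Pi.single a 1) = p + q)
    (h2 : f' (Pi.single a Complex.I) = Complex.I * (p - q)) : dzbar a f Z = q := by
  rw [dzbar, hf.fderiv, h1, h2, ← mul_assoc, Complex.I_mul_I]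
  ring

theorem dz_congr {f g : Symm n → ℂ} {Z : Symm n} (h : f =ᶠ[nhds Z] g) (a : Sym2 (Fin n)) :
    dz a f Z = dz a g Z := by
  rw [dz, dz, h.fderiv_eq]

theorem dzbar_congr {f g : Symm n → ℂ} {Z : Symm n} (h : f =ᶠ[nhds Z] g) (a : Sym2 (Fin n)) :
    dzbar a f Z = dzbar a g Z := by
  rw [dzbar, dzbar, h.fderiv_eq]

theorem dz_const_mul (c : ℂ) {f : Symm n → ℂ} {Z : Symm n} (hf : DifferentiableAt ℝ f Z)
    (a : Sym2 (Fin n)) : dz a (fun W => c * f W) Z = c * dz a f Z := by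
  have h := (hf.hasFDerivAt.const_mul c).fderiv
  rw [dz, dz, h]
  simp only [_root_.smul_apply, smul_eq_mul]
  ring

theorem dzbar_const_sub_mul (c d : ℂ) {f : Symm n → ℂ} {Z : Symm n} (hf : DifferentiableAt ℝ f Z)
    (a : Sym2 (Fin n)) : dzbar a (fun W => c - d * f W) Z = -d * dzbar a f Z := by
  have h := ((hf.hasFDerivAt.const_mul d).const_sub c).fderiv
  rw [dzbar, dzbar, h]
  simp only [_root_.neg_apply, _root_.smul_apply, smul_eq_mul]
  ring

/-- The basis vectors of the space of symmetric matrices. -/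
noncomputable def basisMat (a : Sym2 (Fin n)) : Matrix (Fin n) (Fin n) ℂ := mat (Pi.single a 1)

theorem mat_eq_sum (U : Symm n) : mat U = ∑ a, U a • basisMat a := by
  have h := congrArg matL (pi_eq_sum_univ' U)
  simp only [map_sum, map_smul, matL_apply] at h
  rw [h]
  rfl

theorem cbar_mat_eq_sum (V : Symm n) : cbar (mat V) = ∑ b, conj (V b) • basisMat b :=
  mat_eq_sum fun b => conj (V b)

theorem mat_single_I (a : Sym2 (Fin n)) :
    mat (Pi.single a Complex.I) = Complex.I • basisMat a := by
  rw [mat_eq_sum, Finset.sum_eq_single a]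
  · simp
  · intro b _ hb
    simp [hb]
  · simp

theorem cbar_mat_single_one (a : Sym2 (Fin n)) :
    cbar (mat (Pi.single a 1)) = basisMat a := by
  rw [cbar_mat_eq_sum, Finset.sum_eq_single a]
  · simp
  · intro b _ hb
    simp [hb]
  · simp

theorem cbar_mat_single_I (a : Sym2 (Fin n)) :
    cbar (mat (Pi.single a Complex.I)) = -(Complex.I • basisMat a) := by
  rw [cbar_mat_eq_sum, Finset.sum_eq_single a]
  · simp
  · intro b _ hb
    simp [hb]
  · simp

theorem toC_imM_eq (Z : Symm n) :
    toC (imM (mat Z)) = (2 * Complex.I)⁻¹ • (mat Z - cbar (mat Z)) := by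
  rw [cbar_mat, two_I_smul_toC_imM, smul_smul, inv_mul_cancel₀ (by simp), one_smul]

theorem toC_imM_single_one (a : Sym2 (Fin n)) : toC (imM (mat (Pi.single a 1))) = 0 := by
  rw [toC_imM_eq, cbar_mat_single_one, basisMat, sub_self, smul_zero]

theorem toC_imM_single_I (a : Sym2 (Fin n)) :
    toC (imM (mat (Pi.single a Complex.I))) = basisMat a := by
  rw [toC_imM_eq, cbar_mat_single_I, mat_single_I, sub_neg_eq_add, ← two_smul ℂ, smul_smul,
    smul_smul, mul_assoc, inv_mul_cancel₀ (by simp), one_smul]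

theorem logHermitian_eq {c κ : ℝ} {K : Symm n → Symm n → ℂ} {Z : Symm n}
    {A B : Matrix (Fin n) (Fin n) ℂ}
    (h : ∀ a b, dz a (dzbar b fun W => Complex.log (K W W)) Z
      = κ * (A * basisMat a * B * basisMat b).trace) (hc : c * κ = 1) (U V : Symm n) :
    logHermitian c K Z U V = (A * mat U * B * cbar (mat V)).trace := by
  have hc' : (c : ℂ) * κ = 1 := by exact_mod_cast hc
  rw [logHermitian, mat_eq_sum U, cbar_mat_eq_sum V]
  simp only [h, Finset.mul_sum, Finset.sum_mul, trace_sum, mul_smul_comm, smul_mul_assoc,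
    trace_smul, smul_eq_mul]
  rw [Finset.sum_comm]
  refine Finset.sum_congr rfl fun b _ => Finset.sum_congr rfl fun a _ => ?_
  linear_combination (A * basisMat a * B * basisMat b).trace * U a * conj (V b) * hc'

/-- The second derivatives of `log K` in terms of those of the logarithm of a determinant. -/
theorem dz_dzbar_log_eq {D : Set (Symm n)} (hD : IsOpen D) {K : Symm n → Symm n → ℂ}
    {G : Symm n → Matrix (Fin n) (Fin n) ℂ} {c d : ℂ}
    (hlog : ∀ Z ∈ D, Complex.log (K Z Z) = c - d * Complex.log (G Z).det)
    {a b : Sym2 (Fin n)} {q : Symm n → ℂ}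
    (hdiff : ∀ Z ∈ D, DifferentiableAt ℝ (fun W => Complex.log (G W).det) Z)
    (hq : ∀ Z ∈ D, dzbar b (fun W => Complex.log (G W).det) Z = q Z)
    {Z : Symm n} (hZ : Z ∈ D) (hqd : DifferentiableAt ℝ q Z) :
    dz a (dzbar b fun W => Complex.log (K W W)) Z = -d * dz a q Z := by
  rw [← dz_const_mul _ hqd]
  refine dz_congr ?_ a
  filter_upwards [hD.mem_nhds hZ] with W hW
  rw [← hq W hW, ← dzbar_const_sub_mul c d (hdiff W hW)]
  refine dzbar_congr ?_ b
  filter_upwards [hD.mem_nhds hW] with W' hW' using hlog W' hW'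

theorem mem_slitPlane_of_pos {z : ℂ} (hz : 0 < z) : z ∈ Complex.slitPlane :=
  Or.inl (Complex.pos_iff.1 hz).1

/-- The coordinates, as a real-linear map to matrices. -/
noncomputable def matR (n : ℕ) : Symm n →L[ℝ] Matrix (Fin n) (Fin n) ℂ :=
  LinearMap.toContinuousLinearMap (matL.restrictScalars ℝ)

/-- The real-linear map taking a symmetric matrix to its conjugate. -/
noncomputable def cbarR (n : ℕ) : Symm n →L[ℝ] Matrix (Fin n) (Fin n) ℂ :=
  LinearMap.toContinuousLinearMap
    { toFun := fun Z => cbar (mat Z)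
      map_add' := fun Z W => by ext; simp [cbar, mat]
      map_smul' := fun r Z => by ext; simp [cbar, mat] }

/-- The real-linear map taking a symmetric matrix to its imaginary part. -/
noncomputable def imR (n : ℕ) : Symm n →L[ℝ] Matrix (Fin n) (Fin n) ℂ :=
  LinearMap.toContinuousLinearMap
    { toFun := fun Z => toC (imM (mat Z))
      map_add' := fun Z W => by ext; simp [toC, imM, mat]
      map_smul' := fun r Z => by ext; simp [toC, imM, mat] }

/-- With Y = Im Z and E a the basis matrices, ∂Y/∂z_a = E a/(2i) and ∂Y/∂z̄_b = -E b/(2i). So ∂̄_b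
log det Y = (i/2) tr(Y⁻¹ E b), and ∂_a of it is -(1/4) tr(Y⁻¹ E a Y⁻¹ E b). -/
theorem siegel_dz_dzbar {K : Symm n → Symm n → ℂ} {c d : ℂ}
    (hlog : ∀ Z ∈ siegelDomain n, Complex.log (K Z Z)
      = c - d * Complex.log (toC (imM (mat Z))).det)
    {Z : Symm n} (hZ : Z ∈ siegelDomain n) (a b : Sym2 (Fin n)) :
    dz a (dzbar b fun W => Complex.log (K W W)) Z
      = d / 4 * ((toC (imM (mat Z)))⁻¹ * basisMat a * (toC (imM (mat Z)))⁻¹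
        * basisMat b).trace := by
  have hG : ∀ Z : Symm n, HasFDerivAt (fun W => toC (imM (mat W))) (imR n) Z :=
    fun Z => (imR n).hasFDerivAt
  have hG1 : ∀ a, imR n (Pi.single a 1) = 0 := toC_imM_single_one
  have hG2 : ∀ a, imR n (Pi.single a Complex.I) = basisMat a := toC_imM_single_I
  have hdet : ∀ Z ∈ siegelDomain n, 0 < (toC (imM (mat Z))).det := fun Z hZ =>
    (mem_siegelDomain.1 hZ).det_pos
  obtain ⟨i', hi, hi'⟩ := exists_hasFDerivAt_inv (hG Z) (hdet Z hZ).ne'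
  obtain ⟨t', ht, ht'⟩ := exists_hasFDerivAt_trace_mul hi (hasFDerivAt_const (basisMat b) Z)
  have hq := ht.const_mul (Complex.I / 2)
  rw [dz_dzbar_log_eq isOpen_siegelDomain hlog (b := b)
    (q := fun W => Complex.I / 2 * ((toC (imM (mat W)))⁻¹ * basisMat b).trace)
    (fun Z hZ => ?_) (fun Z hZ => ?_) hZ hq.differentiableAt]
  · rw [dz_eq hq (p := -(1 / 4) * ((toC (imM (mat Z)))⁻¹ * basisMat a * (toC (imM (mat Z)))⁻¹
        * basisMat b).trace) (q := (1 / 4) * ((toC (imM (mat Z)))⁻¹ * basisMat a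
          * (toC (imM (mat Z)))⁻¹ * basisMat b).trace)]
    · ring
    · rw [_root_.smul_apply, ht', hi', hG1]
      simp
    · rw [_root_.smul_apply, ht', hi', hG2]
      simp only [_root_.zero_apply, mul_zero, add_zero, neg_mul, trace_neg, smul_eq_mul]
      ring
  · obtain ⟨f', hf, -⟩ := exists_hasFDerivAt_log_det (hG Z) (mem_slitPlane_of_pos (hdet Z hZ))
    exact hf.differentiableAt
  · obtain ⟨f', hf, hf'⟩ := exists_hasFDerivAt_log_det (hG Z) (mem_slitPlane_of_pos (hdet Z hZ))
    refine dzbar_eq hf (p := -(Complex.I / 2 * ((toC (imM (mat Z)))⁻¹ * basisMat b).trace)) ?_ ?_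
    · rw [hf', hG1]
      simp
    · rw [hf', hG2]
      linear_combination ((toC (imM (mat Z)))⁻¹ * basisMat b).trace * Complex.I_mul_I

/-- This identity merges the two terms of ∂_a tr((1 - Z Z̄)⁻¹ Z E b), one from the inverse and one
from the factor Z, into a single trace. -/
theorem mul_inv_one_sub_mul_add_one {A B : Matrix (Fin n) (Fin n) ℂ} (h : (1 - A * B).det ≠ 0) :
    B * (1 - A * B)⁻¹ * A + 1 = (1 - B * A)⁻¹ := by
  refine (inv_eq_right_inv ?_).symm
  have h1 : (1 - A * B) * (1 - A * B)⁻¹ = 1 := mul_nonsing_inv _ h.isUnit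
  have h2 : (1 - B * A) * (B * (1 - A * B)⁻¹ * A + 1)
      = B * ((1 - A * B) * (1 - A * B)⁻¹) * A + 1 - B * A := by noncomm_ring
  rw [h2, h1]
  noncomm_ring

theorem disc_dz_dzbar {K : Symm n → Symm n → ℂ} {c d : ℂ}
    (hlog : ∀ Z ∈ discDomain n, Complex.log (K Z Z)
      = c - d * Complex.log (1 - mat Z * cbar (mat Z)).det)
    {Z : Symm n} (hZ : Z ∈ discDomain n) (a b : Sym2 (Fin n)) :
    dz a (dzbar b fun W => Complex.log (K W W)) Z
      = d * ((1 - mat Z * cbar (mat Z))⁻¹ * basisMat a * (1 - cbar (mat Z) * mat Z)⁻¹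
        * basisMat b).trace := by
  have hG : ∀ Z : Symm n, ∃ G' : Symm n →L[ℝ] Matrix (Fin n) (Fin n) ℂ,
      HasFDerivAt (fun W => 1 - mat W * cbar (mat W)) G' Z ∧
      (∀ a, G' (Pi.single a 1) = -(basisMat a * cbar (mat Z) + mat Z * basisMat a)) ∧
      ∀ a, G' (Pi.single a Complex.I)
        = -(Complex.I • (basisMat a * cbar (mat Z) - mat Z * basisMat a)) := by
    intro Z
    refine ⟨_, ((matR n).hasFDerivAt.mul' (cbarR n).hasFDerivAt).const_sub 1, fun a => ?_,
      fun a => ?_⟩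
    · change -(mat Z * cbar (mat (Pi.single a 1)) + mat (Pi.single a 1) * cbar (mat Z)) = _
      rw [cbar_mat_single_one, add_comm]
      rfl
    · change -(mat Z * cbar (mat (Pi.single a Complex.I))
        + mat (Pi.single a Complex.I) * cbar (mat Z)) = _
      rw [cbar_mat_single_I, mat_single_I, mul_neg, mul_smul_comm, smul_mul_assoc, smul_sub]
      abel
  choose G' hG hG1 hG2 using hG
  have hdet : ∀ Z ∈ discDomain n, 0 < (1 - mat Z * cbar (mat Z)).det := fun Z hZ =>
    Matrix.PosDef.det_pos hZ
  have hM : HasFDerivAt (fun W => mat W * basisMat b) _ Z :=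
    (matR n).hasFDerivAt.mul' (hasFDerivAt_const (basisMat b) Z)
  obtain ⟨i', hi, hi'⟩ := exists_hasFDerivAt_inv (hG Z) (hdet Z hZ).ne'
  obtain ⟨t', ht, ht'⟩ := exists_hasFDerivAt_trace_mul hi hM
  have hM' : ∀ v, t' v = (i' v * (mat Z * basisMat b)
      + (1 - mat Z * cbar (mat Z))⁻¹ * (mat Z * 0 + mat v * basisMat b)).trace := ht'
  have hq := ht.const_mul (-1)
  rw [dz_dzbar_log_eq isOpen_discDomain hlog (b := b)
    (q := fun W => -1 * ((1 - mat W * cbar (mat W))⁻¹ * (mat W * basisMat b)).trace)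
    (fun Z hZ => ?_) (fun Z hZ => ?_) hZ hq.differentiableAt]
  · have key := mul_inv_one_sub_mul_add_one (hdet Z hZ).ne'
    generalize (1 - mat Z * cbar (mat Z))⁻¹ = R at *
    rw [← key]
    -- Only Z is differentiated in p and only Z̄ in q; q is needed to separate the two but does not
    -- enter the result.
    rw [dz_eq hq (p := -(R * basisMat a * (cbar (mat Z) * R * mat Z + 1) * basisMat b).trace)
      (q := -(R * mat Z * basisMat a * R * mat Z * basisMat b).trace)]
    · ring
    · rw [_root_.smul_apply, hM', hi', hG1, ← trace_neg, ← trace_neg, ← trace_add, smul_eq_mul,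
        neg_one_mul, ← trace_neg]
      congr 1
      change -(_ + R * (mat Z * 0 + basisMat a * basisMat b)) = _
      noncomm_ring
    · rw [_root_.smul_apply, hM', hi', hG2, mat_single_I, smul_eq_mul, neg_one_mul,
        ← trace_neg, ← trace_neg, ← trace_neg, ← trace_sub, ← smul_eq_mul Complex.I, ← trace_smul]
      congr 1
      simp only [mul_neg, neg_mul, mul_smul_comm, smul_mul_assoc, mul_zero, zero_add, neg_neg,
        ← smul_add, ← smul_neg]
      congr 1
      noncomm_ring
  · obtain ⟨f', hf, -⟩ := exists_hasFDerivAt_log_det (hG Z) (mem_slitPlane_of_pos (hdet Z hZ))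
    exact hf.differentiableAt
  · obtain ⟨f', hf, hf'⟩ := exists_hasFDerivAt_log_det (hG Z) (mem_slitPlane_of_pos (hdet Z hZ))
    refine dzbar_eq hf
      (p := -((1 - mat Z * cbar (mat Z))⁻¹ * (basisMat b * cbar (mat Z))).trace) ?_ ?_
    · rw [hf', hG1, mul_neg, trace_neg, mul_add, trace_add]
      ring
    · rw [hf', hG2, mul_neg, trace_neg, mul_smul_comm, trace_smul, mul_sub, trace_sub, smul_eq_mul]
      ring

theorem discMetric_eq {Z : Symm n} (hZ : Z ∈ discDomain n) (U V : Symm n) :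
    discMetric n Z U V = ((1 - mat Z * cbar (mat Z))⁻¹ * mat U * (1 - cbar (mat Z) * mat Z)⁻¹
      * cbar (mat V)).trace := by
  obtain ⟨c, hlog⟩ :=
    (isBergmanKernel_bergmanKernel (isOpen_discDomain (n := n)) (normMeasure n)).exists_log_disc
  have hn : ((n : ℝ) + 1) ≠ 0 := by positivity
  refine logHermitian_eq (κ := n + 1) (fun a b => ?_) (by field_simp) U V
  rw [disc_dz_dzbar hlog hZ]
  push_cast
  rfl

theorem siegelMetric_eq {Z : Symm n} (hZ : Z ∈ siegelDomain n) (U V : Symm n) :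
    siegelMetric n Z U V = (toC (imM (mat Z))⁻¹ * mat U * toC (imM (mat Z))⁻¹
      * cbar (mat V)).trace := by
  obtain ⟨c, hlog⟩ :=
    (isBergmanKernel_bergmanKernel (isOpen_siegelDomain (n := n)) (normMeasure n)).exists_log_siegel
  have hn : ((n : ℝ) + 1) ≠ 0 := by positivity
  refine logHermitian_eq (κ := (n + 1) / 4) (fun a b => ?_) (by field_simp) U V
  rw [siegel_dz_dzbar hlog hZ, toC_inv _ (Matrix.PosDef.det_pos hZ).ne']
  push_cast
  rfl

theorem cbar_mul (A B : Matrix (Fin n) (Fin n) ℂ) : cbar (A * B) = cbar A * cbar B :=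
  Matrix.map_mul (f := starRingEnd ℂ)

theorem cbar_cbar (A : Matrix (Fin n) (Fin n) ℂ) : cbar (cbar A) = A := by
  ext
  simp [cbar]

theorem cbar_one_sub (A : Matrix (Fin n) (Fin n) ℂ) : cbar (1 - A) = 1 - cbar A := by
  ext j k
  simp [cbar, one_apply, apply_ite]

theorem det_cbar (A : Matrix (Fin n) (Fin n) ℂ) : (cbar A).det = conj A.det :=
  ((starRingEnd ℂ).map_det A).symm

theorem cbar_inv {A : Matrix (Fin n) (Fin n) ℂ} (hA : A.det ≠ 0) : cbar A⁻¹ = (cbar A)⁻¹ := by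
  refine (inv_eq_right_inv ?_).symm
  rw [← cbar_mul, mul_nonsing_inv _ hA.isUnit]
  exact Matrix.map_one _ (map_zero _) (map_one _)

theorem trace_cbar (A : Matrix (Fin n) (Fin n) ℂ) : (cbar A).trace = conj A.trace := by
  simp [trace, cbar]

theorem kahlerForm_disc_eq {Z : Symm n} (hZ : Z ∈ discDomain n) (U V : Symm n) :
    (kahlerForm (discMetric n) Z U V : ℂ) =
      Complex.I * ((1 - mat Z * cbar (mat Z))⁻¹ * mat U * (1 - cbar (mat Z) * mat Z)⁻¹
        * cbar (mat V)).trace -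
      Complex.I * ((1 - cbar (mat Z) * mat Z)⁻¹ * cbar (mat U) * (1 - mat Z * cbar (mat Z))⁻¹
        * mat V).trace := by
  have h1 : kahlerForm (discMetric n) Z U V = -2 * (discMetric n Z U V).im :=
    kahlerForm_logHermitian _ _ Z U V
  have hd : (1 - mat Z * cbar (mat Z)).det ≠ 0 := (Matrix.PosDef.det_pos hZ).ne'
  have e : cbar (1 - mat Z * cbar (mat Z)) = 1 - cbar (mat Z) * mat Z := by
    rw [cbar_one_sub, cbar_mul, cbar_cbar]
  have e' : 1 - mat Z * cbar (mat Z) = cbar (1 - cbar (mat Z) * mat Z) := by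
    rw [cbar_one_sub, cbar_mul, cbar_cbar]
  have hd' : (1 - cbar (mat Z) * mat Z).det ≠ 0 := by
    rw [← e, det_cbar]
    simpa using hd
  -- The second trace is the conjugate of the first, so the difference is 2i times an imaginary
  -- part.
  have h2 : (1 - cbar (mat Z) * mat Z)⁻¹ * cbar (mat U) * (1 - mat Z * cbar (mat Z))⁻¹ * mat V
      = cbar ((1 - mat Z * cbar (mat Z))⁻¹ * mat U * (1 - cbar (mat Z) * mat Z)⁻¹
        * cbar (mat V)) := by
    rw [cbar_mul, cbar_mul, cbar_mul, cbar_cbar, cbar_inv hd, cbar_inv hd', e, ← e']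
  rw [h1, h2, trace_cbar, discMetric_eq hZ, ← mul_sub, Complex.sub_conj]
  push_cast
  linear_combination (2 : ℂ) * (((1 - mat Z * cbar (mat Z))⁻¹ * mat U
    * (1 - cbar (mat Z) * mat Z)⁻¹ * cbar (mat V)).trace.im : ℂ) * -Complex.I_mul_I

theorem mat_eq_re_add_im (A : Matrix (Fin n) (Fin n) ℂ) :
    A = toC (reM A) + Complex.I • toC (imM A) := by
  ext j k
  simp [toC, reM, imM, mul_comm Complex.I]

theorem cbar_eq_re_sub_im (A : Matrix (Fin n) (Fin n) ℂ) :
    cbar A = toC (reM A) - Complex.I • toC (imM A) := by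
  ext j k
  apply Complex.ext <;> simp [cbar, toC, reM, imM]

theorem trace_toC (A : Matrix (Fin n) (Fin n) ℝ) : (toC A).trace = (A.trace : ℂ) := by
  simp [trace, toC]

theorem kahlerForm_siegel_eq {Z : Symm n} (hZ : Z ∈ siegelDomain n) (U V : Symm n) :
    kahlerForm (siegelMetric n) Z U V =
      2 * ((imM (mat Z))⁻¹ * reM (mat U) * (imM (mat Z))⁻¹ * imM (mat V)).trace -
      2 * ((imM (mat Z))⁻¹ * imM (mat U) * (imM (mat Z))⁻¹ * reM (mat V)).trace := by
  have h1 : kahlerForm (siegelMetric n) Z U V = -2 * (siegelMetric n Z U V).im :=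
    kahlerForm_logHermitian _ _ Z U V
  have h2 : siegelMetric n Z U V
      = (((((imM (mat Z))⁻¹ * reM (mat U) * (imM (mat Z))⁻¹ * reM (mat V)).trace
        + ((imM (mat Z))⁻¹ * imM (mat U) * (imM (mat Z))⁻¹ * imM (mat V)).trace : ℝ)) : ℂ)
        + (((((imM (mat Z))⁻¹ * imM (mat U) * (imM (mat Z))⁻¹ * reM (mat V)).trace
        - ((imM (mat Z))⁻¹ * reM (mat U) * (imM (mat Z))⁻¹ * imM (mat V)).trace : ℝ)) : ℂ)
          * Complex.I := by
    rw [siegelMetric_eq hZ, cbar_eq_re_sub_im (mat V)]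
    conv_lhs => rw [mat_eq_re_add_im (mat U)]
    push_cast
    simp only [← trace_toC, toC_mul, mul_add, add_mul, mul_sub, sub_mul, mul_smul_comm,
      smul_mul_assoc, trace_add, trace_sub, trace_smul, smul_eq_mul]
    linear_combination -(toC (imM (mat Z))⁻¹ * toC (imM (mat U)) * toC (imM (mat Z))⁻¹
      * toC (imM (mat V))).trace * Complex.I_mul_I
  rw [h1, h2, Complex.add_im, Complex.ofReal_im, Complex.mul_I_im, Complex.ofReal_re]
  ring

end CartanIII

theorem mainTheorem6 (n : ℕ) (hn : 1 ≤ n) :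
    -- the Bergman kernels exist and are positive on the diagonal
    (CartanIII.IsBergmanKernel (CartanIII.discDomain n) (CartanIII.normMeasure n)
        (CartanIII.bergmanKernel (CartanIII.discDomain n) (CartanIII.normMeasure n)) ∧
      ∀ Z ∈ CartanIII.discDomain n,
        0 < CartanIII.bergmanKernel (CartanIII.discDomain n) (CartanIII.normMeasure n) Z Z) ∧
    (CartanIII.IsBergmanKernel (CartanIII.siegelDomain n) (CartanIII.normMeasure n)
        (CartanIII.bergmanKernel (CartanIII.siegelDomain n) (CartanIII.normMeasure n)) ∧
      ∀ Z ∈ CartanIII.siegelDomain n,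
        0 < CartanIII.bergmanKernel (CartanIII.siegelDomain n) (CartanIII.normMeasure n) Z Z) ∧
    -- the Bergman metrics
    (∀ Z ∈ CartanIII.discDomain n, ∀ U V : CartanIII.Symm n,
      CartanIII.discMetric n Z U V =
        ((1 - CartanIII.mat Z * CartanIII.cbar (CartanIII.mat Z))⁻¹ * CartanIII.mat U *
          (1 - CartanIII.cbar (CartanIII.mat Z) * CartanIII.mat Z)⁻¹ *
          CartanIII.cbar (CartanIII.mat V)).trace) ∧
    (∀ Z ∈ CartanIII.siegelDomain n, ∀ U V : CartanIII.Symm n,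
      CartanIII.siegelMetric n Z U V =
        (CartanIII.toC (CartanIII.imM (CartanIII.mat Z))⁻¹ * CartanIII.mat U *
          CartanIII.toC (CartanIII.imM (CartanIII.mat Z))⁻¹ *
          CartanIII.cbar (CartanIII.mat V)).trace) ∧
    -- the Kähler forms
    (∀ Z ∈ CartanIII.discDomain n, ∀ U V : CartanIII.Symm n,
      (CartanIII.kahlerForm (CartanIII.discMetric n) Z U V : ℂ) =
        Complex.I *
          ((1 - CartanIII.mat Z * CartanIII.cbar (CartanIII.mat Z))⁻¹ * CartanIII.mat U *
            (1 - CartanIII.cbar (CartanIII.mat Z) * CartanIII.mat Z)⁻¹ *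
            CartanIII.cbar (CartanIII.mat V)).trace -
        Complex.I *
          ((1 - CartanIII.cbar (CartanIII.mat Z) * CartanIII.mat Z)⁻¹ *
            CartanIII.cbar (CartanIII.mat U) *
            (1 - CartanIII.mat Z * CartanIII.cbar (CartanIII.mat Z))⁻¹ *
            CartanIII.mat V).trace) ∧
    (∀ Z ∈ CartanIII.siegelDomain n, ∀ U V : CartanIII.Symm n,
      CartanIII.kahlerForm (CartanIII.siegelMetric n) Z U V =
        2 * ((CartanIII.imM (CartanIII.mat Z))⁻¹ * CartanIII.reM (CartanIII.mat U) *
            (CartanIII.imM (CartanIII.mat Z))⁻¹ * CartanIII.imM (CartanIII.mat V)).trace -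
        2 * ((CartanIII.imM (CartanIII.mat Z))⁻¹ * CartanIII.imM (CartanIII.mat U) *
            (CartanIII.imM (CartanIII.mat Z))⁻¹ * CartanIII.reM (CartanIII.mat V)).trace) := by
  have hD := CartanIII.isBergmanKernel_bergmanKernel
    (CartanIII.isOpen_discDomain (n := n)) (CartanIII.normMeasure n)
  have hS := CartanIII.isBergmanKernel_bergmanKernel
    (CartanIII.isOpen_siegelDomain (n := n)) (CartanIII.normMeasure n)
  exact ⟨⟨hD, fun Z hZ => hD.diag_pos CartanIII.isOpen_discDomain hZ (hD.disc_ne_zero hZ)⟩,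
    ⟨hS, fun Z hZ => hS.diag_pos CartanIII.isOpen_siegelDomain hZ (hS.siegel_ne_zero hZ)⟩,
    fun Z hZ => CartanIII.discMetric_eq hZ, fun Z hZ => CartanIII.siegelMetric_eq hZ,
    fun Z hZ => CartanIII.kahlerForm_disc_eq hZ, fun Z hZ => CartanIII.kahlerForm_siegel_eq hZ⟩
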